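/- **Uniform consistency of the maximum likelihood estimator (MLE) in general pairwise comparison models.** *Model.* Let $A\subset\mathbb R$ be a measurable set with $A=-A$, and let $\nu$ be a reference measure on $\mathbb R$ invariant under $x\mapsto -x$ (e.g. Lebesgue measure for continuous outcomes, counting measure for discrete ones); write $\int_A\cdot\,dx$ for integration over $A$ against $\nu$. Let $f(x;y)$, $x\in A$, $y\in\mathbb R$, be a *valid* comparison density: (1) $f\ge 0$, $f(\cdot;y)$ is measurable, and $\int_A f(x;y)\,dx=1$ for all $y$; (2) $f(x;y)=f(-x;-y)$; (3) for $x\in A$ with $x<0$, $f(x;y)$ is non-increasing in $y$ and $f(x;y)\to0$ as $y\to\infty$; (4) $\sup_{y\in\mathbb R}f(x;y)<\infty$ for each $x\in A$. Assume moreover that $f$ is *strictly log-concave* in $y$: for every $x\in A$, $f(x;\cdot)>0$, $\log f(x;\cdot)$ is twice differentiable, and $\partial_y^2\log f(x;y)<0$ for all $y\in\mathbb R$. Put $g(x;y)=\partial_y\log f(x;y)$ and $g_2(x;y)=\partial_y g(x;y)$. For each $n$ let $\mathbf u=\mathbf u_n\in\mathbb R^n$ be the true score vector, with $u_1=0$,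 and let $p_n\in(0,1]$; let $T\ge1$ be a fixed integer. The data for $n$ subjects consist of independent multiplicities $n_{ij}\sim \mathrm{Bin}(T,p_n)$, $1\le i<j\le n$, and, independently of these, independent outcomes $X_{ij}^{(t)}$, where $X^{(t)}_{ij}$ has density $f(\cdot\,;u_i-u_j)$; the outcomes with $t\le n_{ij}$ are observed. The data for all $n$ live on one probability space (with arbitrary dependence between different $n$). The log-likelihood is $$l(\mathbf v)=\sum_{1\le i<j\le n}\ \sum_{t=1}^{n_{ij}}\log f\big(X_{ij}^{(t)};v_i-v_j\big),$$ and an MLE $\hat{\mathbf u}$ is a maximizer of $l$ over $\{\mathbf v\in\mathbb R^n: v_1=0\}$. *Constants.* Let $M_n=\max_{i,j}|u_i-u_j|$ and $$C^{(1)}_n=\int_{A\cap[0,\infty)}f(x;M_n)\,dx,\qquad C^{(2)}_n=\sup_{x\in A,\,|y|\le M_n}|g(x;y)|,$$ $$C^{(3)}_n=\sup_{x\in A,\,|y|\le M_n+1}|g_2(x;y)|,\qquad C^{(4)}_n=\inf_{x\in A,\,|y|\le M_n+1}|g_2(x;y)|,$$ where $C_n^{(2)},C_n^{(3)}\in[0,\infty]$.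 *Theorem.* Assume that, as $n\to\infty$, $$\frac{\log n}{n p_n\,|\log C^{(1)}_n|}\to0\qquad\text{and}\qquad \Delta_n:=\frac{C^{(2)}_nC^{(3)}_n}{(C^{(4)}_n)^2}\sqrt{\frac{\log n}{np_n}}\;\frac{\log n}{\log (np_n)}\to0$$ (where $\Delta_n=\infty$ if $C^{(2)}_n=\infty$, $C^{(3)}_n=\infty$ or $C^{(4)}_n=0$). Then there is a constant $C$ independent of $n$ such that for all sufficiently large $n$, with probability at least $1-14n^{-2}$, the MLE $\hat{\mathbf u}$ exists, is unique, and satisfies $$\|\hat{\mathbf u}-\mathbf u\|_\infty\le C\,\Delta_n .$$ In particular $\hat{\mathbf u}$ is uniformly consistent: almost surely, $\hat{\mathbf u}$ exists and is unique for all but finitely many $n$, and $\|\hat{\mathbf u}-\mathbf u\|_\infty\to0$. -/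

import Mathlib

open MeasureTheory ProbabilityTheory Filter Topology
open scoped NNReal ENNReal

namespace PairwiseComparison

noncomputable section

/-- A *valid* comparison density `f(x; y)`: `x` ranges over the symmetric outcome set `A`, `y` is
the relative score, and `ν` is the reference measure for "density (mass) function"; e.g. Lebesgue
measure for continuous outcomes and counting measure for discrete ones. -/
structure IsValid (A : Set ℝ) (ν : Measure ℝ) (f : ℝ → ℝ → ℝ) : Prop where
  measurableSet : MeasurableSet A
  symm : ∀ x ∈ A, -x ∈ A
  aemeasurable : ∀ y, AEMeasurable (fun x => f x y) (ν.restrict A)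
  nonneg : ∀ x ∈ A, ∀ y, 0 ≤ f x y
  lintegral_eq_one : ∀ y, ∫⁻ x in A, ENNReal.ofReal (f x y) ∂ν = 1
  even : ∀ x ∈ A, ∀ y, f x y = f (-x) (-y)
  antitone : ∀ x ∈ A, x < 0 → Antitone (f x)
  tendsto_zero : ∀ x ∈ A, x < 0 → Tendsto (f x) atTop (𝓝 0)
  bddAbove : ∀ x ∈ A, BddAbove (Set.range (f x))

/-- `g(x; y) = ∂/∂y log f(x; y)`. -/
def score (f : ℝ → ℝ → ℝ) (x y : ℝ) : ℝ :=
  deriv (fun z => Real.log (f x z)) y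

/-- `g₂(x; y) = ∂/∂y g(x; y)`. -/
def scoreDeriv (f : ℝ → ℝ → ℝ) (x y : ℝ) : ℝ :=
  deriv (score f x) y

/-- For every outcome `x ∈ A`, the function `f(x; ·)` is positive, its logarithm is twice
differentiable, and the second derivative of the logarithm is negative everywhere. -/
structure IsStrictlyLogConcave (A : Set ℝ) (f : ℝ → ℝ → ℝ) : Prop where
  pos : ∀ x ∈ A, ∀ y, 0 < f x y
  differentiable_log : ∀ x ∈ A, Differentiable ℝ (fun y => Real.log (f x y))
  differentiable_score : ∀ x ∈ A, Differentiable ℝ (score f x)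
  scoreDeriv_neg : ∀ x ∈ A, ∀ y, scoreDeriv f x y < 0

/-- The law of one comparison with relative score `y`: density `f(·; y)` on `A` with respect to
`ν`. -/
def outcomeLaw (A : Set ℝ) (ν : Measure ℝ) (f : ℝ → ℝ → ℝ) (y : ℝ) : Measure ℝ :=
  (ν.restrict A).withDensity fun x => ENNReal.ofReal (f x y)

/-- The dynamic range `max_{i,j} |u_i - u_j|`. -/
def dynamicRange {n : ℕ} (u : Fin n → ℝ) : ℝ :=
  ⨆ e : Fin n × Fin n, |u e.1 - u e.2|

/-- The global discrepancy `C⁽¹⁾ = ∫_{[0,∞)} f(x; M) dx`. -/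
def C₁ (A : Set ℝ) (ν : Measure ℝ) (f : ℝ → ℝ → ℝ) (M : ℝ) : ℝ :=
  ∫ x in A ∩ Set.Ici 0, f x M ∂ν

/-- `C⁽²⁾ = sup_{x ∈ A, |y| ≤ M} |g(x; y)|`, possibly infinite. -/
def C₂ (A : Set ℝ) (f : ℝ → ℝ → ℝ) (M : ℝ) : ℝ≥0∞ :=
  ⨆ x ∈ A, ⨆ y ∈ Set.Icc (-M) M, ENNReal.ofReal |score f x y|

/-- `C⁽³⁾ = sup_{x ∈ A, |y| ≤ M + 1} |g₂(x; y)|`, possibly infinite. -/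
def C₃ (A : Set ℝ) (f : ℝ → ℝ → ℝ) (M : ℝ) : ℝ≥0∞ :=
  ⨆ x ∈ A, ⨆ y ∈ Set.Icc (-(M + 1)) (M + 1), ENNReal.ofReal |scoreDeriv f x y|

/-- `C⁽⁴⁾ = inf_{x ∈ A, |y| ≤ M + 1} |g₂(x; y)|`, possibly zero. -/
def C₄ (A : Set ℝ) (f : ℝ → ℝ → ℝ) (M : ℝ) : ℝ≥0∞ :=
  ⨅ x ∈ A, ⨅ y ∈ Set.Icc (-(M + 1)) (M + 1), ENNReal.ofReal |scoreDeriv f x y|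

/-- `Δ = C⁽²⁾ C⁽³⁾ / (C⁽⁴⁾)² · √(log n / (n p)) · (log n / log (n p))`. The value is `∞` when
`C⁽²⁾` or `C⁽³⁾` is infinite or `C⁽⁴⁾ = 0` (for `n ≥ 2` and `n p > 1`). -/
def Delta (A : Set ℝ) (f : ℝ → ℝ → ℝ) (M : ℝ) (n : ℕ) (p : ℝ) : ℝ≥0∞ :=
  C₂ A f M * C₃ A f M / C₄ A f M ^ 2 *
    ENNReal.ofReal (√(Real.log n / (n * p)) * (Real.log n / Real.log (n * p)))

/-- Unordered pairs of distinct subjects, listed as `(i, j)` with `i < j`. -/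
abbrev Pair (n : ℕ) : Type := {e : Fin n × Fin n // e.1 < e.2}

/-- The comparison data on `n` subjects with true scores `u`: the multiplicities `N e` are i.i.d.
`Bin(T, p)`; the outcomes `X e t`, `t < T`, are independent, independent of the multiplicities, and
`X (i, j) t` has density `f(·; u_i - u_j)`. Of these, the outcomes with `t < N e` are observed. -/
structure IsComparisonData (A : Set ℝ) (ν : Measure ℝ) (f : ℝ → ℝ → ℝ) (T : ℕ)
    (p : unitInterval) {n : ℕ} (u : Fin n → ℝ) {Ω : Type*} [MeasurableSpace Ω] (P : Measure Ω)
    (N : Pair n → Ω → ℕ) (X : Pair n → Fin T → Ω → ℝ) : Prop where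
  hasLaw_mult : ∀ e, HasLaw (N e) (binomial T p) P
  hasLaw_outcome : ∀ e t, HasLaw (X e t) (outcomeLaw A ν f (u e.1.1 - u e.1.2)) P
  indep_mult : iIndepFun N P
  indep_outcome : iIndepFun (fun (s : Pair n × Fin T) => X s.1 s.2) P
  indep_mult_outcome : IndepFun (fun ω e => N e ω)
    (fun ω (s : Pair n × Fin T) => X s.1 s.2 ω) P

/-- The conditional log-likelihood
`l(v) = ∑_{i < j} ∑_{t ≤ n_ij} log f(X_ij⁽ᵗ⁾; v_i - v_j)`. -/
def logLikelihood (f : ℝ → ℝ → ℝ) {n T : ℕ} (N : Pair n → ℕ) (X : Pair n → Fin T → ℝ)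
    (v : Fin n → ℝ) : ℝ :=
  ∑ e : Pair n, ∑ t : Fin T with t.val < N e, Real.log (f (X e t) (v e.1.1 - v e.1.2))

/-- The parameter space `{v ∈ ℝⁿ : v_1 = 0}` (the first subject has index `0`). -/
def normalized (n : ℕ) : Set (Fin n → ℝ) :=
  {v | ∀ i : Fin n, i.val = 0 → v i = 0}

/-- `v` is a maximum likelihood estimate: a maximizer of the log-likelihood under `v_1 = 0`. -/
def IsMLE (f : ℝ → ℝ → ℝ) {n T : ℕ} (N : Pair n → ℕ) (X : Pair n → Fin T → ℝ)
    (v : Fin n → ℝ) : Prop :=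
  v ∈ normalized n ∧ IsMaxOn (logLikelihood f N X) (normalized n) v

end

end PairwiseComparison

/-!
Let `v` maximize the concave log-likelihood over the band where the coordinates of `v - u` differ by
at most `1`, and consider the level sets of `v - u`. For an upper level set `S`, first-order
optimality makes the total score of the comparisons across the cut `(S, Sᶜ)` nonnegative. At the
true scores this total is a centred sum, of order `C⁽²⁾ √(n p log n) |S|` by Chernoff and union
bounds over all `S`. Replacing `u` by `v` lowers it by at least `C⁽⁴⁾` times the total increment of
`v - u` over the cut comparisons. As a cut carries about `n p |S|` comparisons, most of these must
have increments at most `δ ≈ C⁽²⁾/C⁽⁴⁾ √(log n / (n p))`. Since the random comparison graph is an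
expander, lowering the level by `δ` therefore multiplies the size of `S` by a power of `n p`, until
`S` contains a fixed fraction of the subjects and then, after boundedly many further steps, more
than half of them. The same holds for the lower level sets, and two majorities meet: the oscillation
of `v - u` is of order `δ log n / log (n p)`, that is, `O(Δ)`. When this is less than `1` the
maximizer is interior to the band, hence global, and it is unique because the graph is connected and
`log f` is strictly concave. The exceptional probabilities are summable, so Borel–Cantelli gives the
almost sure statements.
-/

namespace PairwiseComparison

section Expansion

variable {n : ℕ}

/-- The pairs with one member in `S` and the other in `R`. -/
def crossing (S R : Finset (Fin n)) : Finset (Pair n) :=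
  {e | (e.1.1 ∈ S ∧ e.1.2 ∈ R) ∨ (e.1.1 ∈ R ∧ e.1.2 ∈ S)}

lemma mem_crossing {S R : Finset (Fin n)} {e : Pair n} :
    e ∈ crossing S R ↔ (e.1.1 ∈ S ∧ e.1.2 ∈ R) ∨ (e.1.1 ∈ R ∧ e.1.2 ∈ S) := by
  simp [crossing]

lemma crossing_comm (S R : Finset (Fin n)) : crossing S R = crossing R S := by
  ext e
  simp only [mem_crossing, or_comm]

lemma crossing_union (S R Q : Finset (Fin n)) :
    crossing S (R ∪ Q) = crossing S R ∪ crossing S Q := by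
  ext e
  simp only [mem_crossing, Finset.mem_union]
  tauto

lemma disjoint_crossing {S R Q : Finset (Fin n)} (hSR : Disjoint S R) (hSQ : Disjoint S Q)
    (hRQ : Disjoint R Q) : Disjoint (crossing S R) (crossing S Q) := by
  simp only [Finset.disjoint_left, mem_crossing] at *
  grind

lemma card_crossing {S R : Finset (Fin n)} (h : Disjoint S R) :
    (crossing S R).card = S.card * R.card := by
  have hne : ∀ a ∈ S, ∀ b ∈ R, a ≠ b := Finset.disjoint_iff_ne.1 h
  rw [← Finset.card_product]
  refine Finset.card_bij' (fun e _ => if e.1.1 ∈ S then e.1 else e.1.swap)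
    (fun a ha => if hlt : a.1 < a.2 then ⟨a, hlt⟩ else
      ⟨a.swap, lt_of_le_of_ne (not_lt.1 hlt)
        (hne _ (Finset.mem_product.1 ha).1 _ (Finset.mem_product.1 ha).2).symm⟩)
    ?_ ?_ ?_ ?_ <;> grind [mem_crossing]

/-- The set of indices at which `w` is at least `c`. -/
noncomputable def upper (w : Fin n → ℝ) (c : ℝ) : Finset (Fin n) :=
  {i | c ≤ w i}

lemma mem_upper {w : Fin n → ℝ} {c : ℝ} {i : Fin n} : i ∈ upper w c ↔ c ≤ w i := by
  simp [upper]

lemma upper_anti (w : Fin n → ℝ) : Antitone (upper w) :=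
  fun _ _ h _ hi => mem_upper.2 (h.trans (mem_upper.1 hi))

/-- An expansion property of the graph with edge weights `m` and typical degree `x`: every set of
at most half of the vertices sends out a weight proportional to its size, and only half of this
weight can end in a set of at most `b` vertices that is at most `ρ` times as large. -/
structure IsExpander (m : Pair n → ℝ) (x b ρ : ℝ) : Prop where
  nonneg : ∀ e, 0 ≤ m e
  lt_cut : ∀ S : Finset (Fin n), S.Nonempty → 2 * S.card ≤ n →
    S.card * x / 8 < ∑ e ∈ crossing S Sᶜ, m e
  small_lt : ∀ S R : Finset (Fin n), S.Nonempty → Disjoint S R → (R.card : ℝ) ≤ b →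
    (R.card : ℝ) ≤ ρ * S.card → ∑ e ∈ crossing S R, m e < S.card * x / 16

/-- The edges from an upper level set across the next `δ` levels have length at least `δ`, so there
is little weight on them; by expansion the rest of the boundary meets many vertices. -/
lemma IsExpander.card_upper_add_le {m : Pair n → ℝ} {w : Fin n → ℝ} {δ x b ρ c : ℝ}
    (hm : IsExpander m x b ρ) (hδ : 0 < δ)
    (hlevel : ∑ e ∈ crossing (upper w c) (upper w c)ᶜ, m e * |w e.1.1 - w e.1.2| ≤
      δ * ((upper w c).card * x / 16))
    (hne : (upper w c).Nonempty) (hhalf : 2 * (upper w c).card ≤ n) :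
    (upper w c).card + min b (ρ * (upper w c).card) ≤ ((upper w (c - δ)).card : ℝ) := by
  set S := upper w c with hS
  set S' := upper w (c - δ) with hS'
  have hsub : S ⊆ S' := upper_anti w (by linarith)
  have hSR : Disjoint S (S' \ S) := Finset.disjoint_sdiff
  have hSQ : Disjoint S S'ᶜ := disjoint_compl_right.mono_left hsub
  have hRQ : Disjoint (S' \ S) S'ᶜ := disjoint_compl_right.mono_left Finset.sdiff_subset
  have hcompl : Sᶜ = S' \ S ∪ S'ᶜ := by grind [Finset.mem_compl]
  have hsplit (g : Pair n → ℝ) : ∑ e ∈ crossing S Sᶜ, g e =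
      ∑ e ∈ crossing S (S' \ S), g e + ∑ e ∈ crossing S S'ᶜ, g e := by
    rw [hcompl, crossing_union, Finset.sum_union (disjoint_crossing hSR hSQ hRQ)]
  have hfar : δ * ∑ e ∈ crossing S S'ᶜ, m e ≤
      ∑ e ∈ crossing S S'ᶜ, m e * |w e.1.1 - w e.1.2| := by
    rw [Finset.mul_sum]
    refine Finset.sum_le_sum fun e he => ?_
    rw [mul_comm]
    refine mul_le_mul_of_nonneg_left ?_ (hm.nonneg e)
    simp only [mem_crossing, Finset.mem_compl, hS, hS', mem_upper, not_le] at he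
    rcases he with he | he
    · exact le_trans (by linarith) (le_abs_self _)
    · exact le_trans (by linarith) (neg_le_abs _)
  have hnear : 0 ≤ ∑ e ∈ crossing S (S' \ S), m e * |w e.1.1 - w e.1.2| :=
    Finset.sum_nonneg fun e _ => mul_nonneg (hm.nonneg e) (abs_nonneg _)
  have hfar_le : ∑ e ∈ crossing S S'ᶜ, m e ≤ S.card * x / 16 :=
    le_of_mul_le_mul_left (by linarith [hsplit fun e => m e * |w e.1.1 - w e.1.2|]) hδ
  by_contra! hlt
  rw [← Finset.card_sdiff_add_card_eq_card hsub, Nat.cast_add, add_comm, add_lt_add_iff_left,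
    lt_min_iff] at hlt
  have hnear_lt := hm.small_lt S _ hne hSR hlt.1.le hlt.2.le
  linarith [hm.lt_cut S hne hhalf, hsplit m]

/-- The sequence grows geometrically until it reaches `b`, and by `b` per step afterwards. -/
lemma mul_le_of_add_min_le {a : ℕ → ℝ} {b ρ : ℝ} {K J : ℕ} (ha : 1 ≤ a 0) (hb : 0 ≤ b)
    (hρ : 1 ≤ ρ) (hK : b ≤ ρ ^ K) (hstep : ∀ k < K + J, a k + min b (ρ * a k) ≤ a (k + 1)) :
    (J + 1) * b ≤ a (K + J) := by
  have hgeom : ∀ k ≤ K + J, min b (ρ ^ k) ≤ a k := by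
    intro k hk
    induction k with
    | zero => exact (min_le_right _ _).trans (by simpa using ha)
    | succ k ih =>
      have hak := ih (by omega)
      have hak_nonneg : 0 ≤ a k := (le_min hb (by positivity)).trans hak
      have hmin : min b (ρ ^ (k + 1)) ≤ ρ * a k := calc
        min b (ρ ^ (k + 1)) ≤ min (ρ * b) (ρ * ρ ^ k) :=
          min_le_min (le_mul_of_one_le_left hb hρ) (pow_succ' ρ k).le
        _ = ρ * min b (ρ ^ k) := (mul_min_of_nonneg _ _ (by positivity)).symm
        _ ≤ ρ * a k := by gcongr
      linarith [hstep k (by omega), le_min (min_le_left b (ρ ^ (k + 1))) hmin]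
  have hlinear : ∀ j ≤ J, (j + 1) * b ≤ a (K + j) := by
    intro j hj
    induction j with
    | zero => simpa [min_eq_left hK] using hgeom K (by omega)
    | succ j ih =>
      have haj := ih (by omega)
      have hb_le : b ≤ ρ * a (K + j) := by nlinarith [mul_nonneg j.cast_nonneg hb]
      have := hstep (K + j) (by omega)
      rw [min_eq_left hb_le] at this
      push_cast
      rw [← add_assoc]
      linarith
  exact hlinear J le_rfl

lemma IsExpander.lt_two_mul_card_upper {m : Pair n → ℝ} {w : Fin n → ℝ} {δ x ρ : ℝ} {J K : ℕ}
    (hm : IsExpander m x (n / J) ρ) (hδ : 0 < δ) (hρ : 1 ≤ ρ) (hJ : 1 ≤ J) (hK : n / J ≤ ρ ^ K)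
    (hlevel : ∀ c, (upper w c).Nonempty →
      ∑ e ∈ crossing (upper w c) (upper w c)ᶜ, m e * |w e.1.1 - w e.1.2| ≤
      δ * ((upper w c).card * x / 16)) (i : Fin n) :
    n < 2 * (upper w (w i - (K + J : ℕ) * δ)).card := by
  let U : ℕ → Finset (Fin n) := fun k => upper w (w i - k * δ)
  by_contra! hhalf : 2 * (U (K + J)).card ≤ n
  have hmono : Monotone U := fun k l hkl => upper_anti w (by gcongr)
  have hne (k : ℕ) : (U k).Nonempty := ⟨i, mem_upper.2 (sub_le_self _ (by positivity))⟩
  have hgrow : (J + 1) * (n / J : ℝ) ≤ (U (K + J)).card := by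
    refine mul_le_of_add_min_le (a := fun k => ((U k).card : ℝ))
      (by exact_mod_cast Finset.card_pos.2 (hne 0)) (by positivity) hρ hK fun k hk => ?_
    have hhalf_k : 2 * (U k).card ≤ n :=
      (Nat.mul_le_mul_left 2 (Finset.card_le_card (hmono hk.le))).trans hhalf
    have := hm.card_upper_add_le hδ (hlevel _ (hne k)) (hne k) hhalf_k
    rwa [show w i - k * δ - δ = w i - (k + 1 : ℕ) * δ by push_cast; ring] at this
  have hn : (0 : ℝ) < n := by exact_mod_cast i.pos
  have hJ' : (0 : ℝ) < J := by exact_mod_cast hJ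
  have hlt : (n : ℝ) < (J + 1) * (n / J : ℝ) := by
    rw [add_mul, mul_div_cancel₀ _ hJ'.ne']
    linarith [div_pos hn hJ']
  have : n < (U (K + J)).card := by exact_mod_cast hlt.trans_le hgrow
  omega

lemma sub_le_of_lt_two_mul_card_upper {w : Fin n → ℝ} {r : ℝ}
    (hupper : ∀ i, n < 2 * (upper w (w i - r)).card)
    (hlower : ∀ i, n < 2 * (upper (-w) ((-w) i - r)).card) (i j : Fin n) : w i - w j ≤ 2 * r := by
  obtain ⟨k, hk⟩ : (upper w (w i - r) ∩ upper (-w) ((-w) j - r)).Nonempty := by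
    refine Finset.inter_nonempty_of_card_lt_card_add_card (Finset.subset_univ _)
      (Finset.subset_univ _) ?_
    rw [Finset.card_univ, Fintype.card_fin]
    have := hupper i
    have := hlower j
    omega
  simp only [Finset.mem_inter, mem_upper, Pi.neg_apply] at hk
  linarith

end Expansion

section Likelihood

variable {A : Set ℝ} {f : ℝ → ℝ → ℝ} {n T : ℕ} {N : Pair n → ℕ} {X : Pair n → Fin T → ℝ}

lemma IsStrictlyLogConcave.strictConcaveOn (hlc : IsStrictlyLogConcave A f) {x : ℝ} (hx : x ∈ A) :
    StrictConcaveOn ℝ Set.univ fun y => Real.log (f x y) :=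
  strictConcaveOn_univ_of_deriv2_neg (hlc.differentiable_log x hx).continuous
    (hlc.scoreDeriv_neg x hx)

lemma IsStrictlyLogConcave.hasDerivAt_log (hlc : IsStrictlyLogConcave A f) {x : ℝ} (hx : x ∈ A)
    (y : ℝ) : HasDerivAt (fun z => Real.log (f x z)) (score f x y) y :=
  (hlc.differentiable_log x hx y).hasDerivAt

lemma IsStrictlyLogConcave.concaveOn_log_sub (hlc : IsStrictlyLogConcave A f) {x : ℝ} (hx : x ∈ A)
    (i j : Fin n) : ConcaveOn ℝ Set.univ fun v : Fin n → ℝ => Real.log (f x (v i - v j)) := by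
  refine ⟨convex_univ, fun v _ v' _ a b ha hb hab => ?_⟩
  convert (hlc.strictConcaveOn hx).concaveOn.2 (x := v i - v j) (y := v' i - v' j)
    trivial trivial ha hb hab using 3
  simp only [Pi.add_apply, Pi.smul_apply, smul_eq_mul]
  ring

lemma concaveOn_logLikelihood (hlc : IsStrictlyLogConcave A f) (hX : ∀ e t, X e t ∈ A) :
    ConcaveOn ℝ Set.univ (logLikelihood f N X) := by
  refine ⟨convex_univ, fun v _ v' _ a b ha hb hab => ?_⟩
  simp only [logLikelihood, Finset.smul_sum, ← Finset.sum_add_distrib]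
  exact Finset.sum_le_sum fun e _ => Finset.sum_le_sum fun t _ =>
    (hlc.concaveOn_log_sub (hX e t) e.1.1 e.1.2).2 trivial trivial ha hb hab

lemma convex_normalized : Convex ℝ (normalized n) :=
  fun v hv v' hv' a b _ _ _ i hi => by simp [hv i hi, hv' i hi]

lemma isClosed_normalized : IsClosed (normalized n) := by
  simp only [normalized, Set.ofPred_forall]
  exact isClosed_iInter fun i => isClosed_iInter fun _ =>
    isClosed_eq (continuous_apply i) continuous_const

/-- Every cut of the set of subjects is crossed by an observed comparison. -/
def IsConnected (T : ℕ) (N : Pair n → ℕ) : Prop :=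
  ∀ S : Finset (Fin n), S.Nonempty → Sᶜ.Nonempty → ∃ e ∈ crossing S Sᶜ, ∃ t : Fin T, t.val < N e

lemma IsConnected.exists_sub_ne (hconn : IsConnected T N) {v v' : Fin n → ℝ}
    (hv : v ∈ normalized n) (hv' : v' ∈ normalized n) (hne : v ≠ v') :
    ∃ (e : Pair n) (t : Fin T), t.val < N e ∧ v e.1.1 - v e.1.2 ≠ v' e.1.1 - v' e.1.2 := by
  obtain ⟨i, hi⟩ := Function.ne_iff.1 hne
  let S : Finset (Fin n) := {k | v k = v' k}
  have hS : S.Nonempty :=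
    ⟨⟨0, i.pos⟩, by simp [S, hv ⟨0, i.pos⟩ rfl, hv' ⟨0, i.pos⟩ rfl]⟩
  obtain ⟨e, he, t, ht⟩ := hconn S hS ⟨i, by simp [S, hi]⟩
  refine ⟨e, t, ht, fun heq => ?_⟩
  simp only [mem_crossing, S, Finset.mem_compl, Finset.mem_filter_univ] at he
  rcases he with ⟨heq₁, hne₂⟩ | ⟨hne₁, heq₂⟩
  · exact hne₂ (by linarith)
  · exact hne₁ (by linarith)

lemma strictConcaveOn_logLikelihood (hlc : IsStrictlyLogConcave A f) (hX : ∀ e t, X e t ∈ A)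
    (hconn : IsConnected T N) : StrictConcaveOn ℝ (normalized n) (logLikelihood f N X) := by
  refine ⟨convex_normalized, fun v hv v' hv' hne a b ha hb hab => ?_⟩
  obtain ⟨e, t, ht, hdiff⟩ := hconn.exists_sub_ne hv hv' hne
  have hterm (e : Pair n) (t : Fin T) :=
    (hlc.concaveOn_log_sub (hX e t) e.1.1 e.1.2).2 (x := v) (y := v') trivial trivial ha.le hb.le
      hab
  simp only [logLikelihood, Finset.smul_sum, ← Finset.sum_add_distrib]
  refine Finset.sum_lt_sum (fun e _ => Finset.sum_le_sum fun t _ => hterm e t)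
    ⟨e, Finset.mem_univ e, Finset.sum_lt_sum (fun t _ => hterm e t) ⟨t, by simpa using ht, ?_⟩⟩
  convert (hlc.strictConcaveOn (hX e t)).2 trivial trivial hdiff ha hb hab using 3
  simp only [Pi.add_apply, Pi.smul_apply, smul_eq_mul]
  ring

lemma IsMLE.unique (hlc : IsStrictlyLogConcave A f) (hX : ∀ e t, X e t ∈ A)
    (hconn : IsConnected T N) {v v' : Fin n → ℝ} (hv : IsMLE f N X v) (hv' : IsMLE f N X v') :
    v = v' :=
  (strictConcaveOn_logLikelihood hlc hX hconn).eq_of_isMaxOn hv.2 hv'.2 hv.1 hv'.1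

lemma hasFDerivAt_logLikelihood (hlc : IsStrictlyLogConcave A f) (hX : ∀ e t, X e t ∈ A)
    (v : Fin n → ℝ) :
    HasFDerivAt (logLikelihood f N X)
      (∑ e : Pair n, ∑ t : Fin T with t.val < N e, score f (X e t) (v e.1.1 - v e.1.2) •
        (ContinuousLinearMap.proj (R := ℝ) (φ := fun _ : Fin n => ℝ) e.1.1 -
          ContinuousLinearMap.proj e.1.2)) v :=
  HasFDerivAt.fun_sum fun e _ => HasFDerivAt.fun_sum fun t _ =>
    (hlc.hasDerivAt_log (hX e t) _).comp_hasFDerivAt v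
      ((hasFDerivAt_apply e.1.1 v).sub (hasFDerivAt_apply e.1.2 v))

/-- The score vectors whose pairwise differences are within `1` of those of `u`. The likelihood is
first maximized over this set, on which the constants `C₃` and `C₄` control the score. -/
def unitBand (u : Fin n → ℝ) : Set (Fin n → ℝ) :=
  {v | ∀ i j, (v - u) i - (v - u) j ≤ 1}

lemma convex_unitBand (u : Fin n → ℝ) : Convex ℝ (unitBand u) := by
  intro v hv v' hv' a b ha hb hab i j
  have hvij := hv i j
  have hvij' := hv' i j
  simp only [Pi.add_apply, Pi.sub_apply, Pi.smul_apply, smul_eq_mul] at *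
  obtain rfl : b = 1 - a := by linarith
  nlinarith

lemma isClosed_unitBand (u : Fin n → ℝ) : IsClosed (unitBand u) := by
  simp only [unitBand, Set.ofPred_forall]
  exact isClosed_iInter fun i => isClosed_iInter fun j =>
    isClosed_le (by fun_prop) continuous_const

lemma unitBand_mem_nhds {u v : Fin n → ℝ} (hv : ∀ i j, (v - u) i - (v - u) j < 1) :
    unitBand u ∈ 𝓝 v :=
  eventually_all.2 fun i => eventually_all.2 fun j =>
    (ContinuousAt.eventually_lt (f := fun w : Fin n → ℝ => (w - u) i - (w - u) j)
      (by fun_prop) continuousAt_const (hv i j)).mono fun _ => le_of_lt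

lemma norm_sub_le_of_mem_normalized {u v : Fin n → ℝ} (hu : u ∈ normalized n)
    (hv : v ∈ normalized n) {r : ℝ} (hr : 0 ≤ r) (h : ∀ i j, (v - u) i - (v - u) j ≤ r) :
    ‖v - u‖ ≤ r := by
  refine (pi_norm_le_iff_of_nonneg hr).2 fun i => ?_
  have hzero : (v - u) ⟨0, i.pos⟩ = 0 := by simp [hv ⟨0, i.pos⟩ rfl, hu ⟨0, i.pos⟩ rfl]
  rw [Real.norm_eq_abs, abs_le]
  constructor
  · linarith [h ⟨0, i.pos⟩ i]
  · linarith [h i ⟨0, i.pos⟩]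

lemma exists_isMaxOn_unitBand (hlc : IsStrictlyLogConcave A f) (hX : ∀ e t, X e t ∈ A)
    {u : Fin n → ℝ} (hu : u ∈ normalized n) (hn : 0 < n) :
    ∃ v ∈ normalized n, v ∈ unitBand u ∧ IsMaxOn (logLikelihood f N X) (unitBand u) v := by
  have hcompact : IsCompact (normalized n ∩ unitBand u) := by
    refine (isCompact_closedBall u 1).of_isClosed_subset
      (isClosed_normalized.inter (isClosed_unitBand u)) fun v hv => ?_
    rw [mem_closedBall_iff_norm]
    exact norm_sub_le_of_mem_normalized hu hv.1 zero_le_one hv.2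
  obtain ⟨v, ⟨hvn, hvu⟩, hmax⟩ := hcompact.exists_isMaxOn ⟨u, hu, by simp [unitBand]⟩
    fun v _ => (hasFDerivAt_logLikelihood (N := N) hlc hX v).continuousAt.continuousWithinAt
  refine ⟨v, hvn, hvu, fun v' hv' => ?_⟩
  let v₀ : Fin n → ℝ := fun i => v' i - v' ⟨0, hn⟩
  have hv₀ : v₀ ∈ normalized n ∩ unitBand u := by
    refine ⟨fun i hi => ?_, fun i j => ?_⟩
    · rw [show i = ⟨0, hn⟩ from Fin.ext hi]
      exact sub_self _
    · convert hv' i j using 1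
      simp only [v₀, Pi.sub_apply]
      ring
  have hshift : logLikelihood f N X v₀ = logLikelihood f N X v' := by simp [logLikelihood, v₀]
  exact hshift.symm.trans_le (hmax hv₀)

lemma isMLE_of_isMaxOn_unitBand (hlc : IsStrictlyLogConcave A f) (hX : ∀ e t, X e t ∈ A)
    {u v : Fin n → ℝ} (hv : v ∈ normalized n) (hmax : IsMaxOn (logLikelihood f N X) (unitBand u) v)
    (hlt : ∀ i j, (v - u) i - (v - u) j < 1) : IsMLE f N X v :=
  ⟨hv, fun v' _ => IsMaxOn.of_isLocalMax_of_convex_univ (hmax.isLocalMax (unitBand_mem_nhds hlt))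
    (concaveOn_logLikelihood hlc hX) v'⟩

/-- The orientation of a pair relative to `U`: `1` if it leaves `U`, `-1` if it enters `U`,
and `0` otherwise. -/
def orient (U : Finset (Fin n)) (e : Pair n) : ℝ :=
  (if e.1.1 ∈ U then 1 else 0) - (if e.1.2 ∈ U then 1 else 0)

lemma orient_eq_zero {U : Finset (Fin n)} {e : Pair n} (h : e ∉ crossing U Uᶜ) :
    orient U e = 0 := by
  simp only [mem_crossing, Finset.mem_compl, orient] at *
  grind

lemma abs_orient_le (U : Finset (Fin n)) (e : Pair n) : |orient U e| ≤ 1 := by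
  unfold orient
  split_ifs <;> simp

lemma orient_compl (U : Finset (Fin n)) (e : Pair n) : orient Uᶜ e = -orient U e := by
  simp only [Finset.mem_compl, orient]
  grind

/-- Lowering the scores of an upper set `U` of `v - u` by `1` stays inside the unit band. -/
lemma sum_orient_mul_score_nonneg (hlc : IsStrictlyLogConcave A f) (hX : ∀ e t, X e t ∈ A)
    {u v : Fin n → ℝ} (hv : v ∈ unitBand u) (hmax : IsMaxOn (logLikelihood f N X) (unitBand u) v)
    {U : Finset (Fin n)} (hU : ∀ i ∈ U, ∀ j ∉ U, (v - u) j ≤ (v - u) i) :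
    0 ≤ ∑ e ∈ crossing U Uᶜ, orient U e *
      ∑ t : Fin T with t.val < N e, score f (X e t) (v e.1.1 - v e.1.2) := by
  let d : Fin n → ℝ := fun i => if i ∈ U then 1 else 0
  have hvd : v - d ∈ unitBand u := by
    intro i j
    have hij := hv i j
    simp only [Pi.sub_apply, d] at hij hU ⊢
    grind
  have hcone : -d ∈ posTangentConeAt (unitBand u) v := by
    simpa using
      sub_mem_posTangentConeAt_of_segment_subset ((convex_unitBand u).segment_subset hv hvd)
  have hderiv := hmax.localize.hasFDerivWithinAt_nonpos
    (hasFDerivAt_logLikelihood hlc hX v).hasFDerivWithinAt hcone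
  rw [Finset.sum_subset (Finset.subset_univ (crossing U Uᶜ))
    fun e _ he => by rw [orient_eq_zero he, zero_mul]]
  simp only [sum_apply, smul_apply, sub_apply, ContinuousLinearMap.proj_apply, smul_eq_mul,
    ← Finset.sum_mul] at hderiv
  rw [← neg_nonpos, ← Finset.sum_neg_distrib]
  refine (Finset.sum_congr rfl fun e _ => ?_).trans_le hderiv
  simp only [Pi.neg_apply, orient, d]
  ring

/-- The net score of `U` against its complement at the true scores `u`; it has mean zero. -/
noncomputable def cutNoise (f : ℝ → ℝ → ℝ) (u : Fin n → ℝ) (N : Pair n → ℕ)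
    (X : Pair n → Fin T → ℝ) (U : Finset (Fin n)) : ℝ :=
  ∑ e ∈ crossing U Uᶜ,
    orient U e * ∑ t : Fin T with t.val < N e, score f (X e t) (u e.1.1 - u e.1.2)

lemma cutNoise_compl (u : Fin n → ℝ) (U : Finset (Fin n)) :
    cutNoise f u N X Uᶜ = -cutNoise f u N X U := by
  simp only [cutNoise, compl_compl, crossing_comm Uᶜ, orient_compl, neg_mul,
    Finset.sum_neg_distrib]

lemma mul_abs_sub_le_orient_mul_score_sub {u v : Fin n → ℝ} {M c₄ x : ℝ}
    (hM : ∀ i j, |u i - u j| ≤ M)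
    (hanti : AntitoneOn (fun y => score f x y + c₄ * y) (Set.Icc (-(M + 1)) (M + 1)))
    (hv : v ∈ unitBand u) {U : Finset (Fin n)}
    (hU : ∀ i ∈ U, ∀ j ∉ U, (v - u) j ≤ (v - u) i) {e : Pair n} (he : e ∈ crossing U Uᶜ) :
    c₄ * |(v - u) e.1.1 - (v - u) e.1.2| ≤
      orient U e * (score f x (u e.1.1 - u e.1.2) - score f x (v e.1.1 - v e.1.2)) := by
  have hu_abs := abs_le.1 (hM e.1.1 e.1.2)
  have hv₁₂ := hv e.1.1 e.1.2
  have hv₂₁ := hv e.1.2 e.1.1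
  simp only [Pi.sub_apply] at *
  have hu_mem : u e.1.1 - u e.1.2 ∈ Set.Icc (-(M + 1)) (M + 1) := ⟨by linarith, by linarith⟩
  have hv_mem : v e.1.1 - v e.1.2 ∈ Set.Icc (-(M + 1)) (M + 1) := ⟨by linarith, by linarith⟩
  simp only [mem_crossing, Finset.mem_compl] at he
  rcases he with ⟨hin, hout⟩ | ⟨hout, hin⟩ <;> have hle := hU _ hin _ hout
  · rw [abs_of_nonneg (by linarith)]
    simp only [orient, hin, hout, if_true, if_false]
    linarith [hanti hu_mem hv_mem (by linarith)]
  · rw [abs_of_nonpos (by linarith)]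
    simp only [orient, hin, hout, if_true, if_false]
    linarith [hanti hv_mem hu_mem (by linarith)]

lemma mul_sum_crossing_le_cutNoise (hlc : IsStrictlyLogConcave A f) (hX : ∀ e t, X e t ∈ A)
    (hNT : ∀ e, N e ≤ T) {u v : Fin n → ℝ} {M c₄ : ℝ} (hM : ∀ i j, |u i - u j| ≤ M)
    (hanti : ∀ x ∈ A, AntitoneOn (fun y => score f x y + c₄ * y) (Set.Icc (-(M + 1)) (M + 1)))
    (hv : v ∈ unitBand u) (hmax : IsMaxOn (logLikelihood f N X) (unitBand u) v)
    {U : Finset (Fin n)} (hU : ∀ i ∈ U, ∀ j ∉ U, (v - u) j ≤ (v - u) i) :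
    c₄ * ∑ e ∈ crossing U Uᶜ, N e * |(v - u) e.1.1 - (v - u) e.1.2| ≤ cutNoise f u N X U := by
  suffices h : c₄ * ∑ e ∈ crossing U Uᶜ, N e * |(v - u) e.1.1 - (v - u) e.1.2| ≤
      cutNoise f u N X U - ∑ e ∈ crossing U Uᶜ, orient U e *
        ∑ t : Fin T with t.val < N e, score f (X e t) (v e.1.1 - v e.1.2) by
    linarith [sum_orient_mul_score_nonneg hlc hX hv hmax hU]
  rw [cutNoise, ← Finset.sum_sub_distrib, Finset.mul_sum]
  refine Finset.sum_le_sum fun e he => ?_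
  have hsum := Finset.card_nsmul_le_sum (Finset.univ.filter fun t : Fin T => t.val < N e) _ _
    fun t _ => mul_abs_sub_le_orient_mul_score_sub hM (hanti _ (hX e t)) hv hU he
  rwa [Fin.card_filter_val_lt, min_eq_right (hNT e), nsmul_eq_mul, mul_left_comm,
    ← Finset.mul_sum, Finset.sum_sub_distrib, mul_sub] at hsum

lemma sub_le_of_isMaxOn_unitBand (hlc : IsStrictlyLogConcave A f) (hX : ∀ e t, X e t ∈ A)
    (hNT : ∀ e, N e ≤ T) {u v : Fin n → ℝ} {M c₄ δ x ρ : ℝ} {J K : ℕ}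
    (hM : ∀ i j, |u i - u j| ≤ M) (hc₄ : 0 < c₄)
    (hanti : ∀ x ∈ A, AntitoneOn (fun y => score f x y + c₄ * y) (Set.Icc (-(M + 1)) (M + 1)))
    (hv : v ∈ unitBand u) (hmax : IsMaxOn (logLikelihood f N X) (unitBand u) v)
    (hδ : 0 < δ) (hρ : 1 ≤ ρ) (hJ : 1 ≤ J) (hK : n / J ≤ ρ ^ K)
    (hexp : IsExpander (fun e => (N e : ℝ)) x (n / J) ρ)
    (hnoise : ∀ S : Finset (Fin n), S.Nonempty →
      |cutNoise f u N X S| ≤ c₄ * (δ * (S.card * x / 16))) (i j : Fin n) :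
    (v - u) i - (v - u) j ≤ 2 * ((K + J : ℕ) * δ) := by
  refine sub_le_of_lt_two_mul_card_upper
    (hexp.lt_two_mul_card_upper hδ hρ hJ hK fun c hne => le_of_mul_le_mul_left ?_ hc₄)
    (hexp.lt_two_mul_card_upper hδ hρ hJ hK fun c hne => le_of_mul_le_mul_left ?_ hc₄) i j
  · refine (mul_sum_crossing_le_cutNoise hlc hX hNT hM hanti hv hmax fun i hi j hj => ?_).trans
      ((le_abs_self _).trans (hnoise _ hne))
    rw [mem_upper] at hi hj
    linarith
  · have hle := mul_sum_crossing_le_cutNoise hlc hX hNT hM hanti hv hmax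
      (U := (upper (-(v - u)) c)ᶜ) fun i hi j hj => by
        simp only [Finset.mem_compl, mem_upper, Pi.neg_apply, not_not] at hi hj
        linarith
    rw [cutNoise_compl, compl_compl, crossing_comm] at hle
    have habs (e : Pair n) : |(-(v - u)) e.1.1 - (-(v - u)) e.1.2| =
        |(v - u) e.1.1 - (v - u) e.1.2| := by
      rw [Pi.neg_apply, Pi.neg_apply, ← abs_neg]
      ring_nf
    simp only [habs]
    exact hle.trans ((neg_le_abs _).trans (hnoise _ hne))

lemma IsExpander.isConnected {x b ρ : ℝ} (hNT : ∀ e, N e ≤ T)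
    (hexp : IsExpander (fun e => (N e : ℝ)) x b ρ) (hx : 0 ≤ x) : IsConnected T N := by
  have hcut (S : Finset (Fin n)) (hS : S.Nonempty) (hcard : 2 * S.card ≤ n) :
      ∃ e ∈ crossing S Sᶜ, ∃ t : Fin T, t.val < N e := by
    have hpos : 0 < ∑ e ∈ crossing S Sᶜ, (N e : ℝ) :=
      lt_of_le_of_lt (by positivity) (hexp.lt_cut S hS hcard)
    obtain ⟨e, he, hne⟩ := Finset.exists_ne_zero_of_sum_ne_zero hpos.ne'
    have hNe : 0 < N e := Nat.pos_of_ne_zero (by exact_mod_cast hne)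
    exact ⟨e, he, ⟨0, hNe.trans_le (hNT e)⟩, hNe⟩
  intro S hS hSc
  have hcard := Finset.card_compl_add_card S
  rw [Fintype.card_fin] at hcard
  rcases le_total (2 * S.card) n with hhalf | hhalf
  · exact hcut S hS hhalf
  · simpa only [compl_compl, crossing_comm] using hcut Sᶜ hSc (by omega)

theorem existsUnique_isMLE_of_isExpander (hlc : IsStrictlyLogConcave A f)
    (hX : ∀ e t, X e t ∈ A) (hNT : ∀ e, N e ≤ T) {u : Fin n → ℝ} (hu : u ∈ normalized n)
    (hn : 0 < n) {M c₄ δ x ρ : ℝ} {J K : ℕ} (hM : ∀ i j, |u i - u j| ≤ M) (hc₄ : 0 < c₄)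
    (hanti : ∀ x ∈ A, AntitoneOn (fun y => score f x y + c₄ * y) (Set.Icc (-(M + 1)) (M + 1)))
    (hx : 0 ≤ x) (hδ : 0 < δ) (hρ : 1 ≤ ρ) (hJ : 1 ≤ J) (hK : n / J ≤ ρ ^ K)
    (hexp : IsExpander (fun e => (N e : ℝ)) x (n / J) ρ)
    (hnoise : ∀ S : Finset (Fin n), S.Nonempty →
      |cutNoise f u N X S| ≤ c₄ * (δ * (S.card * x / 16)))
    (hlt : 2 * ((K + J : ℕ) * δ) < 1) :
    (∃! v, IsMLE f N X v) ∧ ∀ v, IsMLE f N X v → ‖v - u‖ ≤ 2 * ((K + J : ℕ) * δ) := by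
  obtain ⟨v, hvn, hvu, hmax⟩ := exists_isMaxOn_unitBand (N := N) hlc hX hu hn
  have hsub := sub_le_of_isMaxOn_unitBand hlc hX hNT hM hc₄ hanti hvu hmax hδ hρ hJ hK hexp hnoise
  have hmle : IsMLE f N X v :=
    isMLE_of_isMaxOn_unitBand hlc hX hvn hmax fun i j => (hsub i j).trans_lt hlt
  have huniq (v' : Fin n → ℝ) (hv' : IsMLE f N X v') : v' = v :=
    hv'.unique hlc hX (hexp.isConnected hNT hx) hmle
  refine ⟨⟨v, hmle, huniq⟩, fun v' hv' => ?_⟩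
  rw [huniq v' hv']
  exact norm_sub_le_of_mem_normalized hu hvn (by positivity) hsub

end Likelihood

section Binomial

variable {Ω : Type*} [MeasurableSpace Ω] {P : Measure Ω} {T : ℕ} {p : unitInterval}

lemma mgf_of_hasLaw_binomial {N : Ω → ℕ} (h : HasLaw N (binomial T p) P) (θ : ℝ) :
    mgf (fun ω => (N ω : ℝ)) P θ = (1 + (p : ℝ) * (Real.exp θ - 1)) ^ T := by
  calc mgf (fun ω => (N ω : ℝ)) P θ = ∫ k, Real.exp (θ * (k : ℝ)) ∂(binomial T p) := by
        rw [← h.map_eq, integral_map h.aemeasurable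
          (measurable_of_countable _).aestronglyMeasurable]
        rfl
    _ = (p * Real.exp θ + (1 - p)) ^ T := by
        rw [integral_binomial, add_pow]
        refine Finset.sum_congr (by ext; simp) fun k _ => ?_
        rw [smul_eq_mul, mul_pow, ← Real.exp_nat_mul, mul_comm (k : ℝ) θ]
        ring
    _ = (1 + (p : ℝ) * (Real.exp θ - 1)) ^ T := by ring

lemma mgf_binomial_le {N : Ω → ℕ} (h : HasLaw N (binomial T p) P) (θ : ℝ) :
    mgf (fun ω => (N ω : ℝ)) P θ ≤ Real.exp (T * (p * (Real.exp θ - 1))) := by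
  rw [mgf_of_hasLaw_binomial h, Real.exp_nat_mul]
  refine pow_le_pow_left₀ ?_ (by linarith [Real.add_one_le_exp (p * (Real.exp θ - 1))]) T
  nlinarith [p.2.1, p.2.2, Real.exp_pos θ]

variable {ι : Type*} {N : ι → Ω → ℕ}

lemma aemeasurable_natCast (hlaw : ∀ e, HasLaw (N e) (binomial T p) P) (e : ι) :
    AEMeasurable (fun ω => (N e ω : ℝ)) P :=
  (measurable_of_countable (fun k : ℕ => (k : ℝ))).comp_aemeasurable (hlaw e).aemeasurable

lemma integrable_exp_mul_sum_binomial [IsFiniteMeasure P]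
    (hlaw : ∀ e, HasLaw (N e) (binomial T p) P) (s : Finset ι) (θ : ℝ) :
    Integrable (fun ω => Real.exp (θ * ∑ e ∈ s, (N e ω : ℝ))) P := by
  refine integrable_exp_mul_of_mem_Icc (a := 0) (b := s.card * T)
    (Finset.aemeasurable_fun_sum s fun e _ => aemeasurable_natCast hlaw e) ?_
  have hle : ∀ᵐ ω ∂P, ∀ e ∈ s, N e ω ≤ T :=
    s.eventually_all.2 fun e _ => ae_le_of_hasLaw_binomial (hlaw e)
  filter_upwards [hle] with ω hω
  refine ⟨by positivity, ?_⟩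
  rw [← nsmul_eq_mul]
  exact Finset.sum_le_card_nsmul _ _ _ fun e he => by exact_mod_cast hω e he

lemma mgf_sum_binomial_le (hlaw : ∀ e, HasLaw (N e) (binomial T p) P) (hN : iIndepFun N P)
    (s : Finset ι) (θ : ℝ) :
    mgf (fun ω => ∑ e ∈ s, (N e ω : ℝ)) P θ ≤
      Real.exp (T * p * s.card * (Real.exp θ - 1)) := by
  have hcast : iIndepFun (fun e ω => (N e ω : ℝ)) P :=
    hN.comp (fun _ k => (k : ℝ)) fun _ => measurable_of_countable _
  calc mgf (fun ω => ∑ e ∈ s, (N e ω : ℝ)) P θ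
      = mgf (∑ e ∈ s, fun ω => (N e ω : ℝ)) P θ := by simp only [Finset.sum_fn]
    _ = ∏ e ∈ s, mgf (fun ω => (N e ω : ℝ)) P θ :=
        hcast.mgf_sum₀ (aemeasurable_natCast hlaw) s
    _ ≤ ∏ e ∈ s, Real.exp (T * (p * (Real.exp θ - 1))) :=
        Finset.prod_le_prod (fun _ _ => mgf_nonneg) fun e _ => mgf_binomial_le (hlaw e) θ
    _ = Real.exp (T * p * s.card * (Real.exp θ - 1)) := by
        rw [Finset.prod_const, ← Real.exp_nat_mul]
        ring_nf

lemma exp_sub_one_le_two_mul {θ : ℝ} (h₀ : 0 ≤ θ) (h₁ : θ ≤ 1) : Real.exp θ - 1 ≤ 2 * θ := by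
  have habs := Real.abs_exp_sub_one_le (x := θ) (by rwa [abs_of_nonneg h₀])
  rw [abs_of_nonneg h₀] at habs
  exact (le_abs_self _).trans habs

lemma mgf_sum_binomial_le_exp_two_mul (hlaw : ∀ e, HasLaw (N e) (binomial T p) P)
    (hN : iIndepFun N P) (s : Finset ι) {θ : ℝ} (h₀ : 0 ≤ θ) (h₁ : θ ≤ 1) :
    mgf (fun ω => ∑ e ∈ s, (N e ω : ℝ)) P θ ≤ Real.exp (T * p * s.card * (2 * θ)) := by
  have hp : 0 ≤ (p : ℝ) := p.2.1
  refine (mgf_sum_binomial_le hlaw hN s θ).trans (Real.exp_le_exp.2 ?_)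
  exact mul_le_mul_of_nonneg_left (exp_sub_one_le_two_mul h₀ h₁) (by positivity)

variable [IsFiniteMeasure P]

lemma measureReal_le_sum_binomial_le (hlaw : ∀ e, HasLaw (N e) (binomial T p) P)
    (hN : iIndepFun N P) (s : Finset ι) (b : ℝ) :
    P.real {ω | b ≤ ∑ e ∈ s, (N e ω : ℝ)} ≤ Real.exp (2 * T * p * s.card - b) := by
  refine (measure_ge_le_exp_mul_mgf b zero_le_one
    (integrable_exp_mul_sum_binomial hlaw s 1)).trans ?_
  rw [sub_eq_neg_add, Real.exp_add, neg_one_mul]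
  gcongr
  refine (mgf_sum_binomial_le_exp_two_mul hlaw hN s zero_le_one le_rfl).trans_eq ?_
  ring_nf

lemma measureReal_sum_binomial_le_le (hlaw : ∀ e, HasLaw (N e) (binomial T p) P)
    (hN : iIndepFun N P) (s : Finset ι) (b : ℝ) :
    P.real {ω | ∑ e ∈ s, (N e ω : ℝ) ≤ b} ≤ Real.exp (b - T * p * s.card / 2) := by
  have hp : 0 ≤ (p : ℝ) := p.2.1
  have hexp : Real.exp (-1) - 1 ≤ -1 / 2 := by linarith [Real.exp_neg_one_lt_half]
  refine (measure_le_le_exp_mul_mgf b (neg_nonpos.2 zero_le_one)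
    (integrable_exp_mul_sum_binomial hlaw s (-1))).trans ?_
  rw [sub_eq_add_neg, Real.exp_add, neg_neg, one_mul]
  gcongr
  refine (mgf_sum_binomial_le hlaw hN s (-1)).trans (Real.exp_le_exp.2 ?_)
  nlinarith [show 0 ≤ T * (p : ℝ) * s.card by positivity]

end Binomial

section Observed

variable {Ω : Type*} [MeasurableSpace Ω] {P : Measure Ω} {ι : Type*} {T : ℕ}

/-- The sum of the variables `y (e, t)` with `e ∈ s` and `t < k e`. -/
def observedSum (s : Finset ι) (k : ι → ℕ) (y : ι × Fin T → ℝ) : ℝ :=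
  ∑ q ∈ s ×ˢ Finset.univ with q.2.val < k q.1, y q

lemma observedSum_eq_sum_sum (s : Finset ι) (k : ι → ℕ) (y : ι × Fin T → ℝ) :
    observedSum s k y = ∑ e ∈ s, ∑ t : Fin T with t.val < k e, y (e, t) := by
  simp only [observedSum, Finset.sum_filter, Finset.sum_product]

lemma measurable_observedSum (s : Finset ι) :
    Measurable fun z : (ι → ℕ) × (ι × Fin T → ℝ) => observedSum s z.1 z.2 := by
  simp only [observedSum, Finset.sum_filter]
  exact Finset.measurable_fun_sum _ fun q _ =>
    Measurable.ite (measurableSet_lt measurable_const (by fun_prop)) (by fun_prop) measurable_const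

lemma card_observed_le (s : Finset ι) (k : ι → ℕ) :
    ((s ×ˢ Finset.univ).filter fun q : ι × Fin T => q.2.val < k q.1).card ≤ ∑ e ∈ s, k e := by
  simp only [Finset.card_filter, Finset.sum_product]
  simp only [← Finset.card_filter, Fin.card_filter_val_lt]
  exact Finset.sum_le_sum fun e _ => min_le_right _ _

variable {Y : ι × Fin T → Ω → ℝ} {c : ℝ≥0}

lemma hasSubgaussianMGF_observedSum (hY : ∀ q, HasSubgaussianMGF (Y q) c P)
    (hind : iIndepFun Y P) (s : Finset ι) (k : ι → ℕ) :
    HasSubgaussianMGF (fun ω => observedSum s k fun q => Y q ω) ((∑ e ∈ s, (k e : ℝ≥0)) * c) P := by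
  have hsum := HasSubgaussianMGF.sum_of_iIndepFun hind
    (s := (s ×ˢ Finset.univ).filter fun q : ι × Fin T => q.2.val < k q.1) fun q _ => hY q
  refine ⟨hsum.integrable_exp_mul, fun l => (hsum.mgf_le l).trans (Real.exp_le_exp.2 ?_)⟩
  rw [Finset.sum_const, nsmul_eq_mul]
  gcongr
  exact_mod_cast card_observed_le s k

lemma lintegral_comp_prod_le_of_indepFun [IsFiniteMeasure P] {α β : Type*} [MeasurableSpace α]
    [MeasurableSpace β] {K : Ω → α} {Z : Ω → β} (hK : AEMeasurable K P) (hZ : AEMeasurable Z P)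
    (hKZ : IndepFun K Z P) {F : α × β → ℝ≥0∞} (hF : Measurable F) {G : α → ℝ≥0∞}
    (hG : Measurable G) (h : ∀ k, ∫⁻ ω, F (k, Z ω) ∂P ≤ G k) :
    ∫⁻ ω, F (K ω, Z ω) ∂P ≤ ∫⁻ ω, G (K ω) ∂P := by
  calc ∫⁻ ω, F (K ω, Z ω) ∂P = ∫⁻ z, F z ∂(P.map fun ω => (K ω, Z ω)) :=
        (lintegral_map' hF.aemeasurable (hK.prodMk hZ)).symm
    _ = ∫⁻ k, ∫⁻ y, F (k, y) ∂(P.map Z) ∂(P.map K) := by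
        rw [(indepFun_iff_map_prod_eq_prod_map_map hK hZ).1 hKZ, lintegral_prod _ hF.aemeasurable]
    _ ≤ ∫⁻ k, G k ∂(P.map K) := by
        refine lintegral_mono fun k => ?_
        rw [lintegral_map' (by fun_prop) hZ]
        exact h k
    _ = ∫⁻ ω, G (K ω) ∂P := lintegral_map' hG.aemeasurable hK

lemma measureReal_ge_le_of_lintegral_exp_le [IsFiniteMeasure P] {W : Ω → ℝ}
    (hW : AEMeasurable W P) {l r : ℝ} (hl : 0 ≤ l)
    (h : ∫⁻ ω, ENNReal.ofReal (Real.exp (l * W ω)) ∂P ≤ ENNReal.ofReal (Real.exp r)) (b : ℝ) :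
    P.real {ω | b ≤ W ω} ≤ Real.exp (r - l * b) := by
  have hexp : AEMeasurable (fun ω => Real.exp (l * W ω)) P := (hW.const_mul l).exp
  have hnonneg : 0 ≤ᵐ[P] fun ω => Real.exp (l * W ω) := ae_of_all _ fun _ => (Real.exp_pos _).le
  have hint : Integrable (fun ω => Real.exp (l * W ω)) P :=
    ⟨hexp.aestronglyMeasurable,
      (hasFiniteIntegral_iff_ofReal hnonneg).2 (h.trans_lt ENNReal.ofReal_lt_top)⟩
  refine (measure_ge_le_exp_mul_mgf b hl hint).trans ?_
  rw [sub_eq_neg_add, Real.exp_add, neg_mul]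
  gcongr
  rw [mgf, integral_eq_lintegral_of_nonneg_ae hnonneg hexp.aestronglyMeasurable]
  exact ENNReal.toReal_le_of_le_ofReal (Real.exp_pos _).le h

variable [IsFiniteMeasure P] [Countable ι] {p : unitInterval} {N : ι → Ω → ℕ}

lemma lintegral_exp_mul_observedSum_le (hlaw : ∀ e, HasLaw (N e) (binomial T p) P)
    (hN : iIndepFun N P) (hY : ∀ q, HasSubgaussianMGF (Y q) c P) (hind : iIndepFun Y P)
    (hNY : IndepFun (fun ω e => N e ω) (fun ω q => Y q ω) P) (s : Finset ι) {l : ℝ}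
    (hl : c * l ^ 2 / 2 ≤ 1) :
    ∫⁻ ω, ENNReal.ofReal (Real.exp (l * observedSum s (fun e => N e ω) fun q => Y q ω)) ∂P ≤
      ENNReal.ofReal (Real.exp (T * p * s.card * (c * l ^ 2))) := by
  have hsum : Measurable fun k : ι → ℕ => ∑ e ∈ s, (k e : ℝ) :=
    Finset.measurable_fun_sum _ fun e _ =>
      (measurable_of_countable (fun k : ℕ => (k : ℝ))).comp (measurable_pi_apply e)
  refine (lintegral_comp_prod_le_of_indepFun
    (F := fun z => ENNReal.ofReal (Real.exp (l * observedSum s z.1 z.2)))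
    (G := fun k => ENNReal.ofReal (Real.exp (c * l ^ 2 / 2 * ∑ e ∈ s, (k e : ℝ))))
    (aemeasurable_pi_lambda _ fun e => (hlaw e).aemeasurable)
    (aemeasurable_pi_lambda _ fun q => (hY q).aemeasurable) hNY
    ((measurable_observedSum s).const_mul l).exp.ennreal_ofReal
    (hsum.const_mul _).exp.ennreal_ofReal fun k => ?_).trans ?_
  · have hk := hasSubgaussianMGF_observedSum hY hind s k
    rw [← ofReal_integral_eq_lintegral_ofReal (hk.integrable_exp_mul l)
      (ae_of_all _ fun _ => (Real.exp_pos _).le)]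
    refine ENNReal.ofReal_le_ofReal ((hk.mgf_le l).trans_eq ?_)
    push_cast
    ring_nf
  · rw [← ofReal_integral_eq_lintegral_ofReal (integrable_exp_mul_sum_binomial hlaw s _)
      (ae_of_all _ fun _ => (Real.exp_pos _).le)]
    refine ENNReal.ofReal_le_ofReal
      ((mgf_sum_binomial_le_exp_two_mul hlaw hN s (by positivity) hl).trans_eq ?_)
    ring_nf

lemma measureReal_le_observedSum_le (hlaw : ∀ e, HasLaw (N e) (binomial T p) P)
    (hN : iIndepFun N P) (hY : ∀ q, HasSubgaussianMGF (Y q) c P) (hind : iIndepFun Y P)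
    (hNY : IndepFun (fun ω e => N e ω) (fun ω q => Y q ω) P) (s : Finset ι) {l : ℝ}
    (hl₀ : 0 ≤ l) (hl : c * l ^ 2 / 2 ≤ 1) (b : ℝ) :
    P.real {ω | b ≤ observedSum s (fun e => N e ω) fun q => Y q ω} ≤
      Real.exp (T * p * s.card * (c * l ^ 2) - l * b) :=
  measureReal_ge_le_of_lintegral_exp_le ((measurable_observedSum s).comp_aemeasurable
    ((aemeasurable_pi_lambda _ fun e => (hlaw e).aemeasurable).prodMk
      (aemeasurable_pi_lambda _ fun q => (hY q).aemeasurable))) hl₀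
    (lintegral_exp_mul_observedSum_le hlaw hN hY hind hNY s hl) b

lemma measureReal_le_abs_observedSum_le (hlaw : ∀ e, HasLaw (N e) (binomial T p) P)
    (hN : iIndepFun N P) (hY : ∀ q, HasSubgaussianMGF (Y q) c P) (hind : iIndepFun Y P)
    (hNY : IndepFun (fun ω e => N e ω) (fun ω q => Y q ω) P) (s : Finset ι) {l : ℝ}
    (hl₀ : 0 ≤ l) (hl : c * l ^ 2 / 2 ≤ 1) (b : ℝ) :
    P.real {ω | b ≤ |observedSum s (fun e => N e ω) fun q => Y q ω|} ≤
      2 * Real.exp (T * p * s.card * (c * l ^ 2) - l * b) := by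
  have hneg := measureReal_le_observedSum_le hlaw hN (fun q => (hY q).neg)
    (hind.comp (fun _ y => -y) fun _ => measurable_neg)
    (hNY.comp measurable_id measurable_neg) s hl₀ hl b
  simp only [Pi.neg_apply, observedSum, Finset.sum_neg_distrib] at hneg
  simp only [le_abs, Set.ofPred_or]
  rw [two_mul]
  exact (measureReal_union_le _ _).trans
    (add_le_add (measureReal_le_observedSum_le hlaw hN hY hind hNY s hl₀ hl b) hneg)

end Observed

section UnionBound

variable {Ω : Type*} [MeasurableSpace Ω] {P : Measure Ω} {n T : ℕ}

lemma measureReal_exists_and_le [IsFiniteMeasure P] {ι : Type*} [Fintype ι] {q : ι → Prop}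
    [DecidablePred q] {B : ι → Ω → Prop} {b : ι → ℝ} (h : ∀ i, q i → P.real {ω | B i ω} ≤ b i) :
    P.real {ω | ∃ i, q i ∧ B i ω} ≤ ∑ i with q i, b i := by
  have hunion : {ω | ∃ i, q i ∧ B i ω} = ⋃ i ∈ Finset.univ.filter q, {ω | B i ω} := by
    ext
    simp
  rw [hunion]
  exact (measureReal_biUnion_finset_le _ _).trans
    (Finset.sum_le_sum fun i hi => h i (Finset.mem_filter.1 hi).2)

lemma sum_exp_mul_card_le (hn : 1 ≤ n) :
    ∑ S : Finset (Fin n), Real.exp (-(3 * Real.log n) * S.card) ≤ 1 + 2 / (n : ℝ) ^ 2 := by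
  have hn₁ : (1 : ℝ) ≤ n := by exact_mod_cast hn
  have hinv : 1 / (n : ℝ) ^ 2 ≤ 1 := (div_le_one (by positivity)).2 (one_le_pow₀ hn₁)
  have hexp : Real.exp (-(3 * Real.log n)) = 1 / (n : ℝ) ^ 3 := by
    rw [Real.exp_neg, mul_comm, Real.exp_mul, Real.exp_log (by positivity), one_div]
    norm_cast
  calc ∑ S : Finset (Fin n), Real.exp (-(3 * Real.log n) * S.card)
      = (Real.exp (-(3 * Real.log n)) + 1) ^ n := by
        simp only [mul_comm (-(3 * Real.log n)), Real.exp_nat_mul]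
        simpa using Fintype.sum_pow_mul_eq_add_pow (Fin n) (Real.exp (-(3 * Real.log n))) 1
    _ ≤ Real.exp (1 / (n : ℝ) ^ 3) ^ n := by
        rw [hexp]
        exact pow_le_pow_left₀ (by positivity) (Real.add_one_le_exp _) n
    _ = Real.exp (1 / (n : ℝ) ^ 2) := by
        rw [← Real.exp_nat_mul]
        congr 1
        field_simp
    _ ≤ 1 + 2 * (1 / (n : ℝ) ^ 2) := by
        linarith [exp_sub_one_le_two_mul (by positivity) hinv]
    _ = 1 + 2 / (n : ℝ) ^ 2 := by ring

lemma sum_exp_mul_card_filter_le (hn : 1 ≤ n) {q : Finset (Fin n) → Prop} [DecidablePred q]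
    (hq : ∀ S, q S → S.Nonempty) :
    ∑ S with q S, Real.exp (-(3 * Real.log n) * S.card) ≤ 2 / (n : ℝ) ^ 2 := by
  have hle := (Finset.sum_le_sum_of_subset_of_nonneg
    (f := fun S : Finset (Fin n) => Real.exp (-(3 * Real.log n) * S.card))
    (Finset.subset_univ (insert ∅ (Finset.univ.filter q))) fun _ _ _ =>
      (Real.exp_pos _).le).trans (sum_exp_mul_card_le hn)
  rw [Finset.sum_insert fun h => Finset.not_nonempty_empty (hq ∅ (Finset.mem_filter.1 h).2),
    Finset.card_empty, Nat.cast_zero, mul_zero, Real.exp_zero] at hle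
  linarith

variable [IsFiniteMeasure P] {p : unitInterval} {N : Pair n → Ω → ℕ}

lemma measureReal_exists_sparse_cut_le (hlaw : ∀ e, HasLaw (N e) (binomial T p) P)
    (hN : iIndepFun N P) (hT : 1 ≤ T) (hn : 1 ≤ n) (hx : 24 * Real.log n ≤ n * (p : ℝ)) :
    P.real {ω | ∃ S : Finset (Fin n), (S.Nonempty ∧ 2 * S.card ≤ n) ∧
      ∑ e ∈ crossing S Sᶜ, (N e ω : ℝ) ≤ S.card * (n * (p : ℝ)) / 8} ≤ 2 / (n : ℝ) ^ 2 := by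
  refine (measureReal_exists_and_le fun S hS => (measureReal_sum_binomial_le_le hlaw hN _ _).trans
    (Real.exp_le_exp.2 ?_)).trans (sum_exp_mul_card_filter_le hn fun S hS => hS.1)
  have hp : 0 ≤ (p : ℝ) := p.2.1
  have hT' : (1 : ℝ) ≤ T := by exact_mod_cast hT
  have hcompl : (n : ℝ) / 2 ≤ (Sᶜ).card := by
    have hle : n ≤ 2 * (Sᶜ).card := by
      rw [Finset.card_compl, Fintype.card_fin]
      omega
    have hle' : (n : ℝ) ≤ 2 * (Sᶜ).card := by exact_mod_cast hle
    linarith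
  have hmean : (S.card : ℝ) * (n * p) / 2 ≤ T * p * (crossing S Sᶜ).card := by
    calc (S.card : ℝ) * (n * p) / 2 = 1 * p * (S.card * (n / 2)) := by ring
      _ ≤ T * p * (S.card * (Sᶜ).card) := by gcongr
      _ = T * p * (crossing S Sᶜ).card := by
        rw [card_crossing disjoint_compl_right, Nat.cast_mul]
  nlinarith [mul_le_mul_of_nonneg_left hx S.card.cast_nonneg]

lemma measureReal_exists_dense_pair_le (hlaw : ∀ e, HasLaw (N e) (binomial T p) P)
    (hN : iIndepFun N P) (hT : 1 ≤ T) (hn : 2 ≤ n) (hx : 192 * Real.log n ≤ n * (p : ℝ))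
    (S : Finset (Fin n)) :
    P.real {ω | ∃ R : Finset (Fin n), (Disjoint S R ∧ (R.card : ℝ) ≤ n / (64 * T : ℕ) ∧
        R.card ≤ n * (p : ℝ) / (192 * Real.log n) * S.card) ∧
        S.card * (n * (p : ℝ)) / 16 ≤ ∑ e ∈ crossing S R, (N e ω : ℝ)} ≤
      Real.exp (-(3 * Real.log n) * S.card) * (1 + 2 / (n : ℝ) ^ 2) := by
  have hp : 0 ≤ (p : ℝ) := p.2.1
  have : (0 : ℝ) < T := by exact_mod_cast hT
  have hL : 0 < Real.log n := Real.log_pos (by exact_mod_cast hn)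
  calc _ ≤ ∑ R : Finset (Fin n) with (Disjoint S R ∧ (R.card : ℝ) ≤ n / (64 * T : ℕ) ∧
          R.card ≤ n * (p : ℝ) / (192 * Real.log n) * S.card),
          Real.exp (-(3 * Real.log n) * S.card) * Real.exp (-(3 * Real.log n) * R.card) := by
        classical
        refine measureReal_exists_and_le fun R ⟨hdisj, hsmall, hratio⟩ =>
          (measureReal_le_sum_binomial_le hlaw hN _ _).trans ?_
        rw [← Real.exp_add, Real.exp_le_exp, card_crossing hdisj, Nat.cast_mul]
        rw [Nat.cast_mul, Nat.cast_ofNat, le_div_iff₀ (by positivity)] at hsmall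
        rw [div_mul_eq_mul_div, le_div_iff₀ (by positivity)] at hratio
        have hs : (0 : ℝ) ≤ S.card := S.card.cast_nonneg
        nlinarith [mul_le_mul_of_nonneg_left hsmall (mul_nonneg hp hs),
          mul_le_mul_of_nonneg_left hx hs]
    _ ≤ ∑ R : Finset (Fin n),
          Real.exp (-(3 * Real.log n) * S.card) * Real.exp (-(3 * Real.log n) * R.card) :=
        Finset.sum_le_sum_of_subset_of_nonneg (Finset.subset_univ _) fun _ _ _ => by positivity
    _ ≤ _ := by
        rw [← Finset.mul_sum]
        exact mul_le_mul_of_nonneg_left (sum_exp_mul_card_le (by omega)) (Real.exp_pos _).le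

lemma measureReal_not_isExpander_le (hlaw : ∀ e, HasLaw (N e) (binomial T p) P)
    (hN : iIndepFun N P) (hT : 1 ≤ T) (hn : 2 ≤ n) (hx : 192 * Real.log n ≤ n * (p : ℝ)) :
    P.real {ω | ¬IsExpander (fun e => (N e ω : ℝ)) (n * p) (n / (64 * T : ℕ))
      (n * p / (192 * Real.log n))} ≤ 5 / (n : ℝ) ^ 2 := by
  have hL : 0 ≤ Real.log n := Real.log_natCast_nonneg n
  have hinv : 2 / (n : ℝ) ^ 2 ≤ 1 / 2 := by
    have hn' : (2 : ℝ) ≤ n := by exact_mod_cast hn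
    rw [div_le_div_iff₀ (by positivity) two_pos]
    nlinarith
  have hsparse := measureReal_exists_sparse_cut_le hlaw hN hT (by omega) (by linarith)
  have hdense := (measureReal_exists_and_le (q := fun S : Finset (Fin n) => S.Nonempty)
    fun S _ => measureReal_exists_dense_pair_le hlaw hN hT hn hx S).trans_eq
      (Finset.sum_mul ..).symm
  calc _ ≤ 2 / (n : ℝ) ^ 2 + _ := by
        refine (measureReal_mono fun ω hω => ?_).trans
          ((measureReal_union_le _ _).trans (add_le_add hsparse hdense))
        by_contra hgood
        simp only [Set.mem_union, Set.mem_ofPred_eq, not_or, not_exists, not_and, not_le,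
          and_imp] at hgood
        exact hω ⟨fun e => by positivity, hgood.1, fun S R hS => hgood.2 S hS R⟩
    _ ≤ 2 / (n : ℝ) ^ 2 + 2 / (n : ℝ) ^ 2 * (3 / 2) := by
        gcongr
        · exact sum_exp_mul_card_filter_le (by omega) fun S hS => hS
        · linarith
    _ = 5 / (n : ℝ) ^ 2 := by ring

lemma measureReal_large_noise_le (hlaw : ∀ e, HasLaw (N e) (binomial T p) P)
    (hN : iIndepFun N P) {Y : Pair n × Fin T → Ω → ℝ} {C : ℝ≥0} (hC : 0 < C)
    (hY : ∀ q, HasSubgaussianMGF (Y q) (C ^ 2) P) (hind : iIndepFun Y P)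
    (hNY : IndepFun (fun ω e => N e ω) (fun ω q => Y q ω) P) (hn : 2 ≤ n)
    (hx : Real.log n ≤ n * (p : ℝ)) (S : Finset (Fin n)) :
    P.real {ω | (T + 3) * C * √(Real.log n * (n * p)) * S.card ≤
        |observedSum (crossing S Sᶜ) (fun e => N e ω) fun q => Y q ω|} ≤
      2 * Real.exp (-(3 * Real.log n) * S.card) := by
  have hL : 0 < Real.log n := Real.log_pos (by exact_mod_cast hn)
  set L := Real.log n
  set x := (n : ℝ) * (p : ℝ) with hx_def
  have hx_pos : 0 < x := hL.trans_le hx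
  have hp : 0 ≤ (p : ℝ) := p.2.1
  -- `l` minimizes the exponent of the Chernoff bound up to a constant.
  set l := √(L / x) / C with hl_def
  have hl_sq : ((C ^ 2 : ℝ≥0) : ℝ) * l ^ 2 = L / x := by
    rw [hl_def, div_pow, Real.sq_sqrt (by positivity), NNReal.coe_pow,
      mul_div_cancel₀ _ (by positivity)]
  have hl_mul : l * (C * √(L * x)) = L := by
    rw [hl_def, ← mul_assoc, div_mul_cancel₀ _ (by positivity), ← Real.sqrt_mul (by positivity),
      show L / x * (L * x) = L ^ 2 by field_simp, Real.sqrt_sq hL.le]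
  have hl_le : ((C ^ 2 : ℝ≥0) : ℝ) * l ^ 2 / 2 ≤ 1 := by
    rw [hl_sq]
    linarith [(div_le_one hx_pos).2 hx]
  have hcard : ((crossing S Sᶜ).card : ℝ) ≤ S.card * n := by
    rw [card_crossing disjoint_compl_right]
    have hle := Finset.card_le_univ Sᶜ
    rw [Fintype.card_fin] at hle
    exact_mod_cast Nat.mul_le_mul_left _ hle
  refine (measureReal_le_abs_observedSum_le hlaw hN hY hind hNY _ (by positivity) hl_le _).trans ?_
  rw [hl_sq]
  gcongr
  calc T * (p : ℝ) * (crossing S Sᶜ).card * (L / x) - l * ((T + 3) * C * √(L * x) * S.card)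
      = T * (p : ℝ) * (crossing S Sᶜ).card * (L / x) -
          (T + 3) * (l * (C * √(L * x))) * S.card := by ring
    _ ≤ T * (p : ℝ) * (S.card * n) * (L / x) - (T + 3) * L * S.card := by rw [hl_mul]; gcongr
    _ = T * S.card * (x * (L / x)) - (T + 3) * L * S.card := by rw [hx_def]; ring
    _ = -(3 * L) * S.card := by rw [mul_div_cancel₀ _ hx_pos.ne']; ring

end UnionBound

section Density

variable {A : Set ℝ} {ν : Measure ℝ} {f : ℝ → ℝ → ℝ}

lemma IsValid.ae_mem (hf : IsValid A ν f) : ∀ᵐ x ∂ν.restrict A, x ∈ A :=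
  ae_restrict_mem hf.measurableSet

lemma IsValid.nonempty (hf : IsValid A ν f) : A.Nonempty := by
  rw [Set.nonempty_iff_ne_empty]
  rintro rfl
  simpa using hf.lintegral_eq_one 0

lemma IsValid.ae_nonneg (hf : IsValid A ν f) (y : ℝ) : 0 ≤ᵐ[ν.restrict A] fun x => f x y := by
  filter_upwards [hf.ae_mem] with x hx using hf.nonneg x hx y

lemma IsValid.integrable (hf : IsValid A ν f) (y : ℝ) :
    Integrable (fun x => f x y) (ν.restrict A) := by
  refine ⟨(hf.aemeasurable y).aestronglyMeasurable, ?_⟩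
  rw [hasFiniteIntegral_iff_ofReal (hf.ae_nonneg y), hf.lintegral_eq_one y]
  exact ENNReal.one_lt_top

lemma IsValid.integral_eq_one (hf : IsValid A ν f) (y : ℝ) : ∫ x in A, f x y ∂ν = 1 := by
  rw [integral_eq_lintegral_of_nonneg_ae (hf.ae_nonneg y) (hf.integrable y).1,
    hf.lintegral_eq_one y, ENNReal.toReal_one]

lemma IsStrictlyLogConcave.hasDerivAt (hlc : IsStrictlyLogConcave A f) {x : ℝ} (hx : x ∈ A)
    (y : ℝ) : HasDerivAt (f x) (score f x y * f x y) y := by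
  have hexp : (fun z => Real.exp (Real.log (f x z))) = f x :=
    funext fun z => Real.exp_log (hlc.pos x hx z)
  have hderiv := (hlc.hasDerivAt_log hx y).exp
  rwa [hexp, Real.exp_log (hlc.pos x hx y), mul_comm] at hderiv

lemma IsValid.aemeasurable_score (hf : IsValid A ν f) (hlc : IsStrictlyLogConcave A f) (y : ℝ) :
    AEMeasurable (fun x => score f x y) (ν.restrict A) := by
  have hlog : ∀ z, AEMeasurable (fun x => Real.log (f x z)) (ν.restrict A) := fun z =>
    Real.measurable_log.comp_aemeasurable (hf.aemeasurable z)
  have hstep : Tendsto (fun k : ℕ => (1 : ℝ) / (k + 1)) atTop (𝓝[≠] 0) :=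
    tendsto_nhdsWithin_iff.2 ⟨tendsto_one_div_add_atTop_nhds_zero_nat,
      Eventually.of_forall fun k => Nat.one_div_pos_of_nat.ne'⟩
  refine aemeasurable_of_tendsto_metrizable_ae atTop
    (fun k : ℕ => ((hlog (y + 1 / (k + 1))).sub (hlog y)).const_mul ((1 : ℝ) / (k + 1))⁻¹) ?_
  filter_upwards [hf.ae_mem] with x hx
  exact (hlc.hasDerivAt_log hx y).tendsto_slope_zero.comp hstep

lemma abs_sub_le_of_abs_deriv_le_ball {h : ℝ → ℝ} {c y z : ℝ} (hd : Differentiable ℝ h)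
    (hc : ∀ w ∈ Metric.ball y 1, |deriv h w| ≤ c) (hz : z ∈ Metric.ball y 1) :
    |h z - h y| ≤ c := by
  have hy : y ∈ Metric.ball y 1 := Metric.mem_ball_self one_pos
  calc |h z - h y| ≤ c * |z - y| :=
        (convex_ball y 1).norm_image_sub_le_of_norm_deriv_le (fun w _ => hd w) hc hy hz
    _ ≤ c := mul_le_of_le_one_right ((abs_nonneg _).trans (hc y hy)) (Metric.mem_ball.1 hz).le

lemma IsStrictlyLogConcave.abs_score_le_add (hlc : IsStrictlyLogConcave A f) {x y z c : ℝ}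
    (hx : x ∈ A) (hc : ∀ w ∈ Metric.ball y 1, |scoreDeriv f x w| ≤ c)
    (hz : z ∈ Metric.ball y 1) : |score f x z| ≤ |score f x y| + c := by
  have hsub := abs_sub_le_of_abs_deriv_le_ball (hlc.differentiable_score x hx) hc hz
  linarith [abs_sub_abs_le_abs_sub (score f x z) (score f x y)]

lemma IsStrictlyLogConcave.le_mul_exp (hlc : IsStrictlyLogConcave A f) {x y z c : ℝ}
    (hx : x ∈ A) (hc : ∀ w ∈ Metric.ball y 1, |score f x w| ≤ c) (hz : z ∈ Metric.ball y 1) :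
    f x z ≤ f x y * Real.exp c := by
  have hsub := abs_sub_le_of_abs_deriv_le_ball (hlc.differentiable_log x hx) hc hz
  calc f x z = Real.exp (Real.log (f x z)) := (Real.exp_log (hlc.pos x hx z)).symm
    _ ≤ Real.exp (Real.log (f x y) + c) := Real.exp_le_exp.2 (by linarith [le_of_abs_le hsub])
    _ = f x y * Real.exp c := by rw [Real.exp_add, Real.exp_log (hlc.pos x hx y)]

lemma IsValid.integral_score (hf : IsValid A ν f) (hlc : IsStrictlyLogConcave A f)
    {y c₂ c₃ : ℝ} (hc₂ : ∀ x ∈ A, |score f x y| ≤ c₂)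
    (hc₃ : ∀ x ∈ A, ∀ z ∈ Metric.ball y 1, |scoreDeriv f x z| ≤ c₃) :
    ∫ x in A, score f x y * f x y ∂ν = 0 := by
  have hscore : ∀ x ∈ A, ∀ z ∈ Metric.ball y 1, |score f x z| ≤ c₂ + c₃ := fun x hx z hz =>
    (hlc.abs_score_le_add hx (hc₃ x hx) hz).trans (by linarith [hc₂ x hx])
  have hderiv : HasDerivAt (fun z => ∫ x in A, f x z ∂ν) (∫ x in A, score f x y * f x y ∂ν) y := by
    refine (hasDerivAt_integral_of_dominated_loc_of_deriv_le
      (F' := fun z x => score f x z * f x z)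
      (bound := fun x => (c₂ + c₃) * (f x y * Real.exp (c₂ + c₃)))
      (Metric.ball_mem_nhds y one_pos)
      (Eventually.of_forall fun z => (hf.aemeasurable z).aestronglyMeasurable) (hf.integrable y)
      ((hf.aemeasurable_score hlc y).mul (hf.aemeasurable y)).aestronglyMeasurable ?_
      (((hf.integrable y).mul_const _).const_mul _) ?_).2
    · filter_upwards [hf.ae_mem] with x hx z hz
      rw [norm_mul, Real.norm_eq_abs, Real.norm_eq_abs, abs_of_pos (hlc.pos x hx z)]
      exact mul_le_mul (hscore x hx z hz) (hlc.le_mul_exp hx (hscore x hx) hz)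
        (hlc.pos x hx z).le ((abs_nonneg _).trans (hscore x hx z hz))
    · filter_upwards [hf.ae_mem] with x hx z _ using hlc.hasDerivAt hx z
  simp only [hf.integral_eq_one] at hderiv
  exact hderiv.unique (hasDerivAt_const y 1)

lemma IsValid.measure_sdiff_zero_ne_zero (hf : IsValid A ν f) (hlc : IsStrictlyLogConcave A f) :
    ν (A \ {0}) ≠ 0 := by
  intro hnull
  have hone : ∀ y, ∫⁻ x in A ∩ {0}, ENNReal.ofReal (f x y) ∂ν = 1 := fun y => by
    rw [← hf.lintegral_eq_one y]
    refine setLIntegral_congr (ae_eq_set.2 ⟨?_, ?_⟩)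
    · rw [Set.sdiff_eq_empty.2 Set.inter_subset_left, measure_empty]
    · rwa [Set.sdiff_self_inter]
  have hA : (0 : ℝ) ∈ A := by
    by_contra hA
    simpa [Set.inter_singleton_eq_empty.2 hA] using hone 0
  have hconst : ∀ y, f 0 y = (ν {0})⁻¹.toReal := fun y => by
    have hmass := hone y
    rw [Set.inter_eq_self_of_subset_right (Set.singleton_subset_iff.2 hA),
      lintegral_singleton] at hmass
    rw [← ENNReal.eq_inv_of_mul_eq_one_left hmass, ENNReal.toReal_ofReal (hf.nonneg 0 hA y)]
  have hscore : score f 0 = fun _ => 0 := by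
    funext y
    simp only [score, hconst, deriv_const]
  exact (hlc.scoreDeriv_neg 0 hA 0).ne (by rw [scoreDeriv, hscore, deriv_const])

lemma IsValid.exists_mem_neg (hf : IsValid A ν f) (hlc : IsStrictlyLogConcave A f) :
    ∃ x ∈ A, x < 0 := by
  obtain ⟨x, hx, hx₀⟩ := nonempty_of_measure_ne_zero (hf.measure_sdiff_zero_ne_zero hlc)
  rcases lt_or_gt_of_ne hx₀ with hneg | hpos
  · exact ⟨x, hx, hneg⟩
  · exact ⟨-x, hf.symm x hx, neg_lt_zero.2 hpos⟩

lemma IsValid.measure_inter_Ioi [ν.IsNegInvariant] (hf : IsValid A ν f) :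
    ν (A ∩ Set.Ioi 0) = ν (A ∩ Set.Iio 0) := by
  rw [← Measure.measure_preimage_neg ν (A ∩ Set.Iio 0)]
  congr 1
  ext x
  simp only [Set.mem_inter_iff, Set.mem_Ioi, Set.mem_preimage, Set.mem_Iio, Left.neg_neg_iff]
  exact and_congr_left fun _ => ⟨hf.symm x, fun h => neg_neg x ▸ hf.symm _ h⟩

lemma IsValid.measure_inter_Iio_ne_zero [ν.IsNegInvariant] (hf : IsValid A ν f)
    (hlc : IsStrictlyLogConcave A f) : ν (A ∩ Set.Iio 0) ≠ 0 := by
  refine fun hnull => hf.measure_sdiff_zero_ne_zero hlc (measure_mono_null ?_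
    (measure_union_null hnull (hf.measure_inter_Ioi.trans hnull)))
  rw [← Set.inter_union_distrib_left, Set.Iio_union_Ioi]
  exact subset_rfl

lemma IsValid.setIntegral_pos (hf : IsValid A ν f) (hlc : IsStrictlyLogConcave A f)
    {B : Set ℝ} (hB : ν (A ∩ B) ≠ 0) (y : ℝ) : 0 < ∫ x in A ∩ B, f x y ∂ν := by
  have hle : ν.restrict (A ∩ B) ≤ ν.restrict A :=
    Measure.restrict_mono Set.inter_subset_left le_rfl
  have hsupp : A ∩ B ⊆ Function.support fun x => f x y := fun x hx => (hlc.pos x hx.1 y).ne'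
  rw [setIntegral_pos_iff_support_of_nonneg_ae (ae_mono hle (hf.ae_nonneg y))
    ((hf.integrable y).mono_measure hle), Set.inter_eq_self_of_subset_right hsupp]
  exact pos_iff_ne_zero.2 hB

lemma IsValid.C₁_lt_one [ν.IsNegInvariant] (hf : IsValid A ν f)
    (hlc : IsStrictlyLogConcave A f) (M : ℝ) : C₁ A ν f M < 1 := by
  have hsplit := integral_inter_add_sdiff (s := A) (t := Set.Ici (0 : ℝ)) (f := fun x => f x M)
    measurableSet_Ici (hf.integrable M)
  rw [Set.sdiff_eq, Set.compl_Ici, hf.integral_eq_one M] at hsplit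
  unfold C₁
  linarith [hf.setIntegral_pos hlc (hf.measure_inter_Iio_ne_zero hlc) M]

lemma IsValid.integral_pos_outcomes_le_C₁ (hf : IsValid A ν f) {M : ℝ} (hM : 0 ≤ M) :
    ∫ x in A ∩ Set.Ioi 0, f x 0 ∂ν ≤ C₁ A ν f M := by
  have hint : ∀ y (B : Set ℝ), IntegrableOn (fun x => f x y) (A ∩ B) ν := fun y B =>
    IntegrableOn.mono_set (t := A) (hf.integrable y) Set.inter_subset_left
  calc ∫ x in A ∩ Set.Ioi 0, f x 0 ∂ν ≤ ∫ x in A ∩ Set.Ioi 0, f x M ∂ν := by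
        refine setIntegral_mono_on (hint 0 _) (hint M _)
          (hf.measurableSet.inter measurableSet_Ioi) fun x hx => ?_
        rw [hf.even x hx.1 0, hf.even x hx.1 M]
        exact hf.antitone (-x) (hf.symm x hx.1) (neg_lt_zero.2 hx.2) (by linarith)
    _ ≤ C₁ A ν f M := by
        refine setIntegral_mono_set (hint M _) ?_
          (Set.inter_subset_inter_right A Set.Ioi_subset_Ici_self).eventuallyLE
        filter_upwards [ae_restrict_mem (hf.measurableSet.inter measurableSet_Ici)] with x hx
        exact hf.nonneg x hx.1 M

lemma IsValid.exists_abs_log_C₁_le [ν.IsNegInvariant] (hf : IsValid A ν f)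
    (hlc : IsStrictlyLogConcave A f) :
    ∃ B > 0, ∀ M, 0 ≤ M → 0 < |Real.log (C₁ A ν f M)| ∧ |Real.log (C₁ A ν f M)| ≤ B := by
  set c := ∫ x in A ∩ Set.Ioi 0, f x 0 ∂ν
  have hc : 0 < c := hf.setIntegral_pos hlc
    (hf.measure_inter_Ioi.symm ▸ hf.measure_inter_Iio_ne_zero hlc) 0
  have hle : ∀ M, 0 ≤ M → c ≤ C₁ A ν f M := fun M hM => hf.integral_pos_outcomes_le_C₁ hM
  have hlt := hf.C₁_lt_one hlc
  refine ⟨-Real.log c, by linarith [Real.log_neg hc ((hle 0 le_rfl).trans_lt (hlt 0))],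
    fun M hM => ?_⟩
  have hneg := Real.log_neg (hc.trans_le (hle M hM)) (hlt M)
  rw [abs_of_neg hneg]
  exact ⟨neg_pos.2 hneg, neg_le_neg (Real.log_le_log hc (hle M hM))⟩

end Density

section Outcomes

variable {A : Set ℝ} {ν : Measure ℝ} {f : ℝ → ℝ → ℝ}

lemma outcomeLaw_absolutelyContinuous (A : Set ℝ) (ν : Measure ℝ) (f : ℝ → ℝ → ℝ) (y : ℝ) :
    outcomeLaw A ν f y ≪ ν.restrict A :=
  withDensity_absolutelyContinuous _ _

lemma IsValid.integral_outcomeLaw (hf : IsValid A ν f) (y : ℝ) (h : ℝ → ℝ) :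
    ∫ x, h x ∂(outcomeLaw A ν f y) = ∫ x in A, h x * f x y ∂ν := by
  unfold outcomeLaw
  rw [integral_withDensity_eq_integral_toReal_smul₀ (hf.aemeasurable y).ennreal_ofReal
    (ae_of_all _ fun _ => ENNReal.ofReal_lt_top)]
  refine integral_congr_ae ?_
  filter_upwards [hf.ae_nonneg y] with x hx
  rw [ENNReal.toReal_ofReal hx, smul_eq_mul, mul_comm]

variable {n T : ℕ} {p : unitInterval} {u : Fin n → ℝ} {Ω : Type*} [MeasurableSpace Ω]
  {P : Measure Ω} {N : Pair n → Ω → ℕ} {X : Pair n → Fin T → Ω → ℝ}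

lemma IsComparisonData.ae_mult_le (hdata : IsComparisonData A ν f T p u P N X) :
    ∀ᵐ ω ∂P, ∀ e, N e ω ≤ T :=
  ae_all_iff.2 fun e => ae_le_of_hasLaw_binomial (hdata.hasLaw_mult e)

lemma IsComparisonData.ae_outcome_mem (hdata : IsComparisonData A ν f T p u P N X)
    (hf : IsValid A ν f) : ∀ᵐ ω ∂P, ∀ e t, X e t ω ∈ A := by
  refine ae_all_iff.2 fun e => ae_all_iff.2 fun t =>
    ae_of_ae_map (hdata.hasLaw_outcome e t).aemeasurable ?_
  rw [(hdata.hasLaw_outcome e t).map_eq]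
  exact (outcomeLaw_absolutelyContinuous A ν f _).ae_le hf.ae_mem

/-- The contribution to `cutNoise f u N X U` of an observed outcome `x` of the comparison `q`. -/
noncomputable def signedScore (f : ℝ → ℝ → ℝ) (u : Fin n → ℝ) (U : Finset (Fin n))
    (q : Pair n × Fin T) (x : ℝ) : ℝ :=
  orient U q.1 * score f x (u q.1.1.1 - u q.1.1.2)

lemma cutNoise_eq_observedSum (f : ℝ → ℝ → ℝ) (u : Fin n → ℝ) (k : Pair n → ℕ)
    (y : Pair n → Fin T → ℝ) (U : Finset (Fin n)) :
    cutNoise f u k y U =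
      observedSum (crossing U Uᶜ) k fun q => signedScore f u U q (y q.1 q.2) := by
  simp only [cutNoise, observedSum_eq_sum_sum, signedScore, Finset.mul_sum]

lemma IsComparisonData.aemeasurable_signedScore (hdata : IsComparisonData A ν f T p u P N X)
    (hf : IsValid A ν f) (hlc : IsStrictlyLogConcave A f) (U : Finset (Fin n))
    (q : Pair n × Fin T) : AEMeasurable (signedScore f u U q) (P.map (X q.1 q.2)) := by
  rw [(hdata.hasLaw_outcome q.1 q.2).map_eq]
  exact ((hf.aemeasurable_score hlc _).mono_ac
    (outcomeLaw_absolutelyContinuous _ _ _ _)).const_mul _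

lemma IsComparisonData.iIndepFun_signedScore (hdata : IsComparisonData A ν f T p u P N X)
    (hf : IsValid A ν f) (hlc : IsStrictlyLogConcave A f) (U : Finset (Fin n)) :
    iIndepFun (fun q ω => signedScore f u U q (X q.1 q.2 ω)) P :=
  hdata.indep_outcome.comp₀ (signedScore f u U)
    (fun q => (hdata.hasLaw_outcome q.1 q.2).aemeasurable)
    (hdata.aemeasurable_signedScore hf hlc U)

lemma IsComparisonData.indepFun_signedScore (hdata : IsComparisonData A ν f T p u P N X)
    (hf : IsValid A ν f) (hlc : IsStrictlyLogConcave A f) (U : Finset (Fin n)) :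
    IndepFun (fun ω e => N e ω) (fun ω q => signedScore f u U q (X q.1 q.2 ω)) P := by
  have hXm : AEMeasurable (fun ω (s : Pair n × Fin T) => X s.1 s.2 ω) P :=
    aemeasurable_pi_lambda _ fun q => (hdata.hasLaw_outcome q.1 q.2).aemeasurable
  refine hdata.indep_mult_outcome.comp₀ (φ := id) (ψ := fun y q => signedScore f u U q (y q))
    (aemeasurable_pi_lambda _ fun e => (hdata.hasLaw_mult e).aemeasurable) hXm aemeasurable_id
    (aemeasurable_pi_lambda _ fun q => ?_)
  refine AEMeasurable.comp_aemeasurable (g := signedScore f u U q)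
    (f := fun y : Pair n × Fin T → ℝ => y q) ?_ (measurable_pi_apply q).aemeasurable
  rw [AEMeasurable.map_map_of_aemeasurable (measurable_pi_apply q).aemeasurable hXm]
  exact hdata.aemeasurable_signedScore hf hlc U q

lemma IsComparisonData.integral_signedScore (hdata : IsComparisonData A ν f T p u P N X)
    (hf : IsValid A ν f) (hlc : IsStrictlyLogConcave A f) (q : Pair n × Fin T) {c₂ c₃ : ℝ}
    (hc₂ : ∀ x ∈ A, |score f x (u q.1.1.1 - u q.1.1.2)| ≤ c₂)
    (hc₃ : ∀ x ∈ A, ∀ z ∈ Metric.ball (u q.1.1.1 - u q.1.1.2) 1, |scoreDeriv f x z| ≤ c₃)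
    (U : Finset (Fin n)) : ∫ ω, signedScore f u U q (X q.1 q.2 ω) ∂P = 0 := by
  rw [← integral_map (hdata.hasLaw_outcome q.1 q.2).aemeasurable
    (hdata.aemeasurable_signedScore hf hlc U q).aestronglyMeasurable,
    (hdata.hasLaw_outcome q.1 q.2).map_eq]
  simp only [signedScore]
  rw [integral_const_mul, hf.integral_outcomeLaw, hf.integral_score hlc hc₂ hc₃, mul_zero]

lemma hasSubgaussianMGF_of_abs_le [IsProbabilityMeasure P] {Y : Ω → ℝ} {c : ℝ≥0}
    (hY : AEMeasurable Y P) (hle : ∀ᵐ ω ∂P, |Y ω| ≤ c) (hmean : ∫ ω, Y ω ∂P = 0) :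
    HasSubgaussianMGF Y (c ^ 2) P := by
  have hsub := hasSubgaussianMGF_of_mem_Icc_of_integral_eq_zero hY
    (hle.mono fun ω => abs_le.1) hmean
  convert hsub using 2
  apply NNReal.eq
  rw [NNReal.coe_div, coe_nnnorm, sub_neg_eq_add, Real.norm_of_nonneg (by positivity),
    NNReal.coe_ofNat, add_self_div_two]

lemma IsComparisonData.hasSubgaussianMGF_signedScore [IsProbabilityMeasure P]
    (hdata : IsComparisonData A ν f T p u P N X) (hf : IsValid A ν f)
    (hlc : IsStrictlyLogConcave A f) (q : Pair n × Fin T) {c₂ : ℝ≥0} {c₃ : ℝ}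
    (hc₂ : ∀ x ∈ A, |score f x (u q.1.1.1 - u q.1.1.2)| ≤ c₂)
    (hc₃ : ∀ x ∈ A, ∀ z ∈ Metric.ball (u q.1.1.1 - u q.1.1.2) 1, |scoreDeriv f x z| ≤ c₃)
    (U : Finset (Fin n)) :
    HasSubgaussianMGF (fun ω => signedScore f u U q (X q.1 q.2 ω)) (c₂ ^ 2) P := by
  refine hasSubgaussianMGF_of_abs_le ((hdata.aemeasurable_signedScore hf hlc U q).comp_aemeasurable
    (hdata.hasLaw_outcome q.1 q.2).aemeasurable) ?_
    (hdata.integral_signedScore hf hlc q hc₂ hc₃ U)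
  filter_upwards [hdata.ae_outcome_mem hf] with ω hω
  rw [signedScore, abs_mul]
  exact (mul_le_of_le_one_left (abs_nonneg _) (abs_orient_le U q.1)).trans (hc₂ _ (hω q.1 q.2))

lemma IsComparisonData.measureReal_exists_large_cutNoise_le [IsProbabilityMeasure P]
    (hdata : IsComparisonData A ν f T p u P N X) (hf : IsValid A ν f)
    (hlc : IsStrictlyLogConcave A f) {c₂ : ℝ≥0} {c₃ : ℝ} (hc₂_pos : 0 < c₂)
    (hc₂ : ∀ x ∈ A, ∀ i j, |score f x (u i - u j)| ≤ c₂)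
    (hc₃ : ∀ x ∈ A, ∀ i j, ∀ z ∈ Metric.ball (u i - u j) 1, |scoreDeriv f x z| ≤ c₃)
    (hn : 2 ≤ n) (hx : Real.log n ≤ n * (p : ℝ)) :
    P.real {ω | ∃ S : Finset (Fin n), S.Nonempty ∧
      (T + 3) * c₂ * √(Real.log n * (n * p)) * S.card ≤
        |cutNoise f u (fun e => N e ω) (fun e t => X e t ω) S|} ≤ 4 / (n : ℝ) ^ 2 := by
  simp only [cutNoise_eq_observedSum]
  refine (measureReal_exists_and_le fun S _ =>
    measureReal_large_noise_le hdata.hasLaw_mult hdata.indep_mult hc₂_pos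
      (fun q => hdata.hasSubgaussianMGF_signedScore hf hlc q (fun x hx => hc₂ x hx _ _)
        (fun x hx => hc₃ x hx _ _) S)
      (hdata.iIndepFun_signedScore hf hlc S) (hdata.indepFun_signedScore hf hlc S) hn hx S).trans ?_
  rw [← Finset.mul_sum]
  linarith [sum_exp_mul_card_filter_le (n := n) (q := Finset.Nonempty) (by omega) fun S hS => hS,
    show 4 / (n : ℝ) ^ 2 = 2 * (2 / (n : ℝ) ^ 2) by ring]

lemma exists_measurableSet_forall_mem [IsProbabilityMeasure P] {Q : Ω → Prop} {ε : ℝ}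
    (hQ : P.real {ω | ¬Q ω} ≤ ε) :
    ∃ E, MeasurableSet E ∧ 1 - ε ≤ P.real E ∧ ∀ ω ∈ E, Q ω := by
  refine ⟨(toMeasurable P {ω | ¬Q ω})ᶜ, (measurableSet_toMeasurable _ _).compl, ?_,
    fun ω hω => not_not.1 fun h => hω (subset_toMeasurable _ _ h)⟩
  rw [probReal_compl_eq_one_sub (measurableSet_toMeasurable _ _), measureReal_def,
    measure_toMeasurable, ← measureReal_def]
  linarith

end Outcomes

section Constants

variable {A : Set ℝ} {ν : Measure ℝ} {f : ℝ → ℝ → ℝ} {M x z : ℝ}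

lemma le_dynamicRange {n : ℕ} (u : Fin n → ℝ) (i j : Fin n) : |u i - u j| ≤ dynamicRange u :=
  le_ciSup (f := fun e : Fin n × Fin n => |u e.1 - u e.2|) (Set.finite_range _).bddAbove (i, j)

lemma dynamicRange_nonneg {n : ℕ} (u : Fin n → ℝ) : 0 ≤ dynamicRange u :=
  Real.iSup_nonneg fun _ => abs_nonneg _

lemma ofReal_abs_score_le_C₂ (hx : x ∈ A) (hz : z ∈ Set.Icc (-M) M) :
    ENNReal.ofReal |score f x z| ≤ C₂ A f M :=
  le_iSup₂_of_le x hx (le_iSup₂_of_le z hz le_rfl)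

lemma ofReal_abs_scoreDeriv_le_C₃ (hx : x ∈ A) (hz : z ∈ Set.Icc (-(M + 1)) (M + 1)) :
    ENNReal.ofReal |scoreDeriv f x z| ≤ C₃ A f M :=
  le_iSup₂_of_le x hx (le_iSup₂_of_le z hz le_rfl)

lemma abs_score_le_toReal_C₂ (h₂ : C₂ A f M ≠ ⊤) (hx : x ∈ A)
    (hz : z ∈ Set.Icc (-M) M) : |score f x z| ≤ (C₂ A f M).toReal :=
  (ENNReal.ofReal_le_iff_le_toReal h₂).1 (ofReal_abs_score_le_C₂ hx hz)

lemma abs_scoreDeriv_le_toReal_C₃ (h₃ : C₃ A f M ≠ ⊤) (hx : x ∈ A)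
    (hz : z ∈ Set.Icc (-(M + 1)) (M + 1)) : |scoreDeriv f x z| ≤ (C₃ A f M).toReal :=
  (ENNReal.ofReal_le_iff_le_toReal h₃).1 (ofReal_abs_scoreDeriv_le_C₃ hx hz)

lemma C₄_le_ofReal_abs_scoreDeriv (hx : x ∈ A) (hz : z ∈ Set.Icc (-(M + 1)) (M + 1)) :
    C₄ A f M ≤ ENNReal.ofReal |scoreDeriv f x z| :=
  iInf₂_le_of_le x hx (iInf₂_le_of_le z hz le_rfl)

lemma IsStrictlyLogConcave.antitoneOn_score_add (hlc : IsStrictlyLogConcave A f) (hx : x ∈ A) :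
    AntitoneOn (fun y => score f x y + (C₄ A f M).toReal * y) (Set.Icc (-(M + 1)) (M + 1)) := by
  have hderiv (y : ℝ) : HasDerivAt (fun y => score f x y + (C₄ A f M).toReal * y)
      (scoreDeriv f x y + (C₄ A f M).toReal) y := by
    simpa only [mul_one] using! (hlc.differentiable_score x hx y).hasDerivAt.add
      ((hasDerivAt_id y).const_mul (C₄ A f M).toReal)
  refine antitoneOn_of_deriv_nonpos (convex_Icc _ _)
    (fun y _ => (hderiv y).continuousAt.continuousWithinAt)
    (fun y _ => (hderiv y).differentiableAt.differentiableWithinAt) fun y hy => ?_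
  have hle := ENNReal.toReal_mono ENNReal.ofReal_ne_top
    (C₄_le_ofReal_abs_scoreDeriv (f := f) hx (interior_subset hy))
  rw [ENNReal.toReal_ofReal (abs_nonneg _), abs_of_neg (hlc.scoreDeriv_neg x hx y)] at hle
  rw [(hderiv y).deriv]
  linarith

lemma IsValid.score_nonpos (hf : IsValid A ν f) (hlc : IsStrictlyLogConcave A f)
    (hx : x ∈ A) (hx_neg : x < 0) (y : ℝ) : score f x y ≤ 0 := by
  have hanti : Antitone fun z => Real.log (f x z) := fun a b hab =>
    Real.log_le_log (hlc.pos x hx b) (hf.antitone x hx hx_neg hab)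
  exact hanti.deriv_nonpos

lemma IsValid.exists_abs_scoreDeriv_le_abs_score (hf : IsValid A ν f)
    (hlc : IsStrictlyLogConcave A f) (hx : x ∈ A) (hx_neg : x < 0) :
    ∃ z ∈ Set.Ioo (-1) 0, |scoreDeriv f x z| ≤ |score f x 0| := by
  obtain ⟨z, hz, hmvt⟩ := exists_deriv_eq_slope (score f x) (neg_lt_zero.2 one_pos)
    (hlc.differentiable_score x hx).continuous.continuousOn
    (hlc.differentiable_score x hx).differentiableOn
  refine ⟨z, hz, ?_⟩
  have hslope : scoreDeriv f x z = score f x 0 - score f x (-1) := by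
    rw [scoreDeriv, hmvt, zero_sub, neg_neg, div_one]
  rw [abs_of_neg (hlc.scoreDeriv_neg x hx z), abs_of_nonpos (hf.score_nonpos hlc hx hx_neg 0)]
  linarith [hf.score_nonpos hlc hx hx_neg (-1)]

lemma IsValid.C₄_le_C₂ (hf : IsValid A ν f) (hlc : IsStrictlyLogConcave A f) (hM : 0 ≤ M) :
    C₄ A f M ≤ C₂ A f M := by
  obtain ⟨x, hx, hx_neg⟩ := hf.exists_mem_neg hlc
  obtain ⟨z, hz, hle⟩ := hf.exists_abs_scoreDeriv_le_abs_score hlc hx hx_neg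
  exact (C₄_le_ofReal_abs_scoreDeriv hx ⟨by linarith [hz.1], by linarith [hz.2]⟩).trans
    ((ENNReal.ofReal_le_ofReal hle).trans (ofReal_abs_score_le_C₂ hx ⟨by linarith, hM⟩))

lemma IsValid.C₂_ne_zero (hf : IsValid A ν f) (hlc : IsStrictlyLogConcave A f) (hM : 0 ≤ M) :
    C₂ A f M ≠ 0 := by
  obtain ⟨x, hx, hx_neg⟩ := hf.exists_mem_neg hlc
  obtain ⟨z, -, hle⟩ := hf.exists_abs_scoreDeriv_le_abs_score hlc hx hx_neg
  have hpos := (abs_pos.2 (hlc.scoreDeriv_neg x hx z).ne).trans_le hle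
  exact ((ENNReal.ofReal_pos.2 hpos).trans_le
    (ofReal_abs_score_le_C₂ hx ⟨by linarith, hM⟩)).ne'

lemma IsValid.C₃_ne_zero (hf : IsValid A ν f) (hlc : IsStrictlyLogConcave A f) (hM : 0 ≤ M) :
    C₃ A f M ≠ 0 := by
  obtain ⟨x, hx, -⟩ := hf.exists_mem_neg hlc
  exact ((ENNReal.ofReal_pos.2 (abs_pos.2 (hlc.scoreDeriv_neg x hx 0).ne)).trans_le
    (ofReal_abs_scoreDeriv_le_C₃ hx ⟨by linarith, by linarith⟩)).ne'

lemma C₄_le_C₃ (hA : A.Nonempty) (hM : 0 ≤ M) : C₄ A f M ≤ C₃ A f M := by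
  obtain ⟨x, hx⟩ := hA
  have hz : (0 : ℝ) ∈ Set.Icc (-(M + 1)) (M + 1) := ⟨by linarith, by linarith⟩
  exact (C₄_le_ofReal_abs_scoreDeriv hx hz).trans (ofReal_abs_scoreDeriv_le_C₃ hx hz)

lemma C₄_ne_top (hA : A.Nonempty) (hM : 0 ≤ M) : C₄ A f M ≠ ⊤ := by
  obtain ⟨x, hx⟩ := hA
  exact ((C₄_le_ofReal_abs_scoreDeriv hx (z := 0) ⟨by linarith, by linarith⟩).trans_lt
    ENNReal.ofReal_lt_top).ne

/-- The factor `√(log n / x) · (log n / log x)` of `Delta`, where `x` stands for the expected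
degree `n p`. -/
noncomputable def rate (n : ℕ) (x : ℝ) : ℝ :=
  √(Real.log n / x) * (Real.log n / Real.log x)

variable {n : ℕ} {p : ℝ}

lemma IsValid.constants_of_Delta_ne_top (hf : IsValid A ν f) (hlc : IsStrictlyLogConcave A f)
    (hM : 0 ≤ M) (hrate : 0 < rate n (n * p)) (hΔ : Delta A f M n p ≠ ⊤) :
    C₂ A f M ≠ ⊤ ∧ C₃ A f M ≠ ⊤ ∧ C₄ A f M ≠ 0 := by
  have h₂ := hf.C₂_ne_zero hlc hM
  have h₃ := hf.C₃_ne_zero hlc hM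
  have h₄ := C₄_ne_top (f := f) hf.nonempty hM
  have hquot : C₂ A f M * C₃ A f M / C₄ A f M ^ 2 ≠ ⊤ := fun htop => hΔ (by
    rw [Delta, ← rate, htop, ENNReal.top_mul (ENNReal.ofReal_pos.2 hrate).ne'])
  have hprod : C₂ A f M * C₃ A f M ≠ ⊤ := fun htop => hquot (by
    rw [htop, ENNReal.top_div_of_ne_top (ENNReal.pow_ne_top h₄)])
  refine ⟨fun htop => hprod (by rw [htop, ENNReal.top_mul h₃]),
    fun htop => hprod (by rw [htop, ENNReal.mul_top h₂]), fun hzero => hquot ?_⟩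
  rw [hzero, zero_pow two_ne_zero, ENNReal.div_zero (mul_ne_zero h₂ h₃)]

lemma toReal_Delta (hrate : 0 ≤ rate n (n * p)) :
    (Delta A f M n p).toReal =
      (C₂ A f M).toReal * (C₃ A f M).toReal / (C₄ A f M).toReal ^ 2 * rate n (n * p) := by
  rw [Delta, ENNReal.toReal_mul, ENNReal.toReal_div, ENNReal.toReal_mul, ENNReal.toReal_pow,
    ← rate, ENNReal.toReal_ofReal hrate]

lemma div_mul_rate_le_toReal_Delta (hA : A.Nonempty) (hM : 0 ≤ M) (hrate : 0 ≤ rate n (n * p))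
    (h₃ : C₃ A f M ≠ ⊤) (h₄ : C₄ A f M ≠ 0) :
    (C₂ A f M).toReal / (C₄ A f M).toReal * rate n (n * p) ≤ (Delta A f M n p).toReal := by
  have h₄_pos : 0 < (C₄ A f M).toReal := ENNReal.toReal_pos h₄ (C₄_ne_top hA hM)
  have hle : (C₄ A f M).toReal ≤ (C₃ A f M).toReal := ENNReal.toReal_mono h₃ (C₄_le_C₃ hA hM)
  rw [toReal_Delta hrate]
  refine mul_le_mul_of_nonneg_right ?_ hrate
  rw [div_le_div_iff₀ h₄_pos (by positivity), sq, ← mul_assoc]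
  gcongr

lemma IsValid.rate_le_toReal_Delta (hf : IsValid A ν f) (hlc : IsStrictlyLogConcave A f)
    (hM : 0 ≤ M) (hrate : 0 ≤ rate n (n * p)) (h₂ : C₂ A f M ≠ ⊤) (h₃ : C₃ A f M ≠ ⊤)
    (h₄ : C₄ A f M ≠ 0) : rate n (n * p) ≤ (Delta A f M n p).toReal := by
  have h₄_pos : 0 < (C₄ A f M).toReal :=
    ENNReal.toReal_pos h₄ (C₄_ne_top hf.nonempty hM)
  refine (le_mul_of_one_le_left hrate ?_).trans
    (div_mul_rate_le_toReal_Delta hf.nonempty hM hrate h₃ h₄)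
  exact (one_le_div h₄_pos).2 (ENNReal.toReal_mono h₂ (hf.C₄_le_C₂ hlc hM))

end Constants

section Rate

lemma sqrt_le_self_of_one_le {x : ℝ} (hx : 1 ≤ x) : √x ≤ x :=
  Real.sqrt_le_iff.2 ⟨zero_le_one.trans hx, le_self_pow₀ hx two_ne_zero⟩

lemma sqrt_mul_eq_sqrt_div_mul (a : ℝ) {x : ℝ} (hx : 0 < x) : √(a * x) = √(a / x) * x := by
  calc √(a * x) = √(a / x * (x * x)) := by field_simp
    _ = √(a / x) * x := by rw [Real.sqrt_mul' _ (mul_self_nonneg x), Real.sqrt_mul_self hx.le]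

lemma log_sq_le_mul_sqrt {x : ℝ} (hx : 1 ≤ x) : Real.log x ^ 2 ≤ 16 * √x := by
  have hlog : Real.log x = 4 * Real.log √√x := by
    rw [Real.log_sqrt (Real.sqrt_nonneg x), Real.log_sqrt (by linarith)]
    ring
  calc Real.log x ^ 2 ≤ (4 * √√x) ^ 2 :=
        pow_le_pow_left₀ (Real.log_nonneg hx)
          (hlog.trans_le (by gcongr; exact Real.log_le_self (by positivity))) 2
    _ = 16 * √x := by rw [mul_pow, Real.sq_sqrt (by positivity)]; norm_num

lemma rate_pos {n : ℕ} {x : ℝ} (hn : 2 ≤ n) (hx : 1 < x) : 0 < rate n x := by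
  have hL : 0 < Real.log n := Real.log_pos (by exact_mod_cast hn)
  have hl : 0 < Real.log x := Real.log_pos hx
  unfold rate
  positivity

lemma mul_log_le_sqrt {n : ℕ} {x c : ℝ} (hx : 1 < x) (hrate : 16 * c ^ 3 * rate n x ^ 2 ≤ 1) :
    c * Real.log n ≤ √x := by
  have hL : 0 ≤ Real.log n := Real.log_natCast_nonneg n
  have hl : 0 < Real.log x := Real.log_pos hx
  refine le_of_pow_le_pow_left₀ three_ne_zero (Real.sqrt_nonneg x) ?_
  have hcube : 16 * (c * Real.log n) ^ 3 ≤ x * Real.log x ^ 2 := by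
    rw [rate, mul_pow, Real.sq_sqrt (by positivity), div_pow, div_mul_div_comm, ← mul_div_assoc,
      div_le_one (by positivity)] at hrate
    linarith
  have hsqrt : √x ^ 3 = x * √x := by rw [pow_succ, Real.sq_sqrt (by positivity)]
  rw [hsqrt]
  linarith [mul_le_mul_of_nonneg_left (log_sq_le_mul_sqrt hx.le) (by linarith : 0 ≤ x)]

lemma exists_nat_le_pow {x y ρ : ℝ} (hx : 1 < x) (hxy : x ≤ y) (hρ : √x ≤ ρ) :
    ∃ K : ℕ, y ≤ ρ ^ K ∧ K ≤ 3 * (Real.log y / Real.log x) := by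
  have hl : 0 < Real.log x := Real.log_pos hx
  have hratio : 1 ≤ Real.log y / Real.log x :=
    (one_le_div hl).2 (Real.log_le_log (by linarith) hxy)
  have hρ_pos : 0 < ρ := (Real.sqrt_pos.2 (by linarith)).trans_le hρ
  have hlogρ : Real.log x / 2 ≤ Real.log ρ := by
    rw [← Real.log_sqrt (by linarith)]
    exact Real.log_le_log (Real.sqrt_pos.2 (by linarith)) hρ
  refine ⟨⌈2 * (Real.log y / Real.log x)⌉₊, ?_, ?_⟩
  · rw [← Real.log_le_log_iff (by linarith) (by positivity), Real.log_pow]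
    calc Real.log y = 2 * (Real.log y / Real.log x) * (Real.log x / 2) := by field_simp
      _ ≤ ⌈2 * (Real.log y / Real.log x)⌉₊ * Real.log ρ :=
        mul_le_mul (Nat.le_ceil _) hlogρ (by positivity) (by positivity)
  · linarith [Nat.ceil_lt_add_one (show 0 ≤ 2 * (Real.log y / Real.log x) by positivity)]

/-- The constant in front of `Delta` in the error bound. -/
def errorConst (T : ℕ) : ℝ≥0 := 32 * (T + 3) * (64 * T + 3)

lemma exists_chaining_steps {n T : ℕ} {x c : ℝ} (hn : 2 ≤ n) (hT : 1 ≤ T) (hx : 1 < x)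
    (hxn : x ≤ n) (hL : 192 * Real.log n ≤ √x) (hc : 0 ≤ c) :
    ∃ K : ℕ, n / (64 * T : ℕ) ≤ (x / (192 * Real.log n)) ^ K ∧
      2 * ((K + 64 * T : ℕ) * (16 * (T + 3) * c * √(Real.log n / x))) ≤
        errorConst T * (c * rate n x) := by
  have hL_pos : 0 < Real.log n := Real.log_pos (by exact_mod_cast hn)
  have hl : 0 < Real.log x := Real.log_pos hx
  have hratio : 1 ≤ Real.log n / Real.log x :=
    (one_le_div hl).2 (Real.log_le_log (by linarith) hxn)
  have hρ : √x ≤ x / (192 * Real.log n) := by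
    rw [le_div_iff₀ (by positivity)]
    calc √x * (192 * Real.log n) ≤ √x * √x := by gcongr
      _ = x := Real.mul_self_sqrt (by linarith)
  obtain ⟨K, hpow, hK⟩ := exists_nat_le_pow hx hxn hρ
  have hJ : (1 : ℝ) ≤ (64 * T : ℕ) := by exact_mod_cast (by omega : 1 ≤ 64 * T)
  refine ⟨K, (div_le_self (by positivity) hJ).trans hpow, ?_⟩
  have hsteps : ((K + 64 * T : ℕ) : ℝ) ≤ (64 * T + 3) * (Real.log n / Real.log x) := by
    push_cast
    nlinarith [mul_le_mul_of_nonneg_left hratio (Nat.cast_nonneg (α := ℝ) T)]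
  calc 2 * ((K + 64 * T : ℕ) * (16 * (T + 3) * c * √(Real.log n / x)))
      ≤ 2 * ((64 * T + 3) * (Real.log n / Real.log x) *
          (16 * (T + 3) * c * √(Real.log n / x))) := by gcongr
    _ = errorConst T * (c * rate n x) := by
      simp only [errorConst, rate]
      push_cast
      ring

end Rate

section Consistency

variable {A : Set ℝ} {ν : Measure ℝ} {f : ℝ → ℝ → ℝ} {n T : ℕ} {p : unitInterval}

lemma two_le_of_one_lt_mul (hnp : 1 < n * (p : ℝ)) : 2 ≤ n := by
  have hlt : (1 : ℝ) < n := hnp.trans_le (mul_le_of_le_one_right n.cast_nonneg p.2.2)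
  exact_mod_cast hlt

lemma IsValid.mul_log_le_sqrt_of_Delta (hf : IsValid A ν f) (hlc : IsStrictlyLogConcave A f)
    {M : ℝ} (hM : 0 ≤ M) (hT : 1 ≤ T) (hnp : 1 < n * (p : ℝ)) (hΔ : Delta A f M n p ≠ ⊤)
    (hsmall : errorConst T * (Delta A f M n p).toReal ≤ 1 / 2) :
    192 * Real.log n ≤ √(n * p) := by
  have hrate : 0 < rate n (n * p) := rate_pos (two_le_of_one_lt_mul hnp) hnp
  obtain ⟨h₂, h₃, h₄⟩ := hf.constants_of_Delta_ne_top hlc hM hrate hΔ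
  have hT' : (1 : ℝ) ≤ T := by exact_mod_cast hT
  have hconst : (8576 : ℝ) ≤ errorConst T := by
    simp only [errorConst]
    push_cast
    nlinarith
  have hle : rate n (n * p) ≤ 1 / 17152 := by
    nlinarith [hf.rate_le_toReal_Delta hlc hM hrate.le h₂ h₃ h₄]
  refine mul_log_le_sqrt hnp ?_
  nlinarith

lemma existsUnique_isMLE_of_good_sample (hf : IsValid A ν f) (hlc : IsStrictlyLogConcave A f)
    (hT : 1 ≤ T) {u : Fin n → ℝ} (hu : u ∈ normalized n) (hnp : 1 < n * (p : ℝ))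
    (hΔ : Delta A f (dynamicRange u) n p ≠ ⊤)
    (hsmall : errorConst T * (Delta A f (dynamicRange u) n p).toReal ≤ 1 / 2)
    {N : Pair n → ℕ} {X : Pair n → Fin T → ℝ} (hNT : ∀ e, N e ≤ T) (hX : ∀ e t, X e t ∈ A)
    (hexp : IsExpander (fun e => (N e : ℝ)) (n * p) (n / (64 * T : ℕ))
      (n * p / (192 * Real.log n)))
    (hnoise : ∀ S : Finset (Fin n), S.Nonempty → |cutNoise f u N X S| ≤
      (T + 3) * (C₂ A f (dynamicRange u)).toReal * √(Real.log n * (n * p)) * S.card) :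
    (∃! v, IsMLE f N X v) ∧ ∀ v, IsMLE f N X v →
      ‖v - u‖ ≤ errorConst T * (Delta A f (dynamicRange u) n p).toReal := by
  have hn := two_le_of_one_lt_mul hnp
  have hM := dynamicRange_nonneg u
  have hrate : 0 < rate n (n * p) := rate_pos hn hnp
  have hL : 0 < Real.log n := Real.log_pos (by exact_mod_cast hn)
  have hlog := hf.mul_log_le_sqrt_of_Delta hlc hM hT hnp hΔ hsmall
  obtain ⟨h₂, h₃, h₄⟩ := hf.constants_of_Delta_ne_top hlc hM hrate hΔ
  have hc₂ := ENNReal.toReal_pos (hf.C₂_ne_zero hlc hM) h₂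
  have hc₄ := ENNReal.toReal_pos h₄ (C₄_ne_top (f := f) hf.nonempty hM)
  have hquot := div_mul_rate_le_toReal_Delta hf.nonempty hM hrate.le h₃ h₄
  set x : ℝ := n * p
  set c := (C₂ A f (dynamicRange u)).toReal / (C₄ A f (dynamicRange u)).toReal with hc
  have hxn : x ≤ n := mul_le_of_le_one_right n.cast_nonneg p.2.2
  obtain ⟨K, hK, hsteps⟩ := exists_chaining_steps hn hT hnp hxn hlog (div_nonneg hc₂.le hc₄.le)
  have herror := hsteps.trans (mul_le_mul_of_nonneg_left hquot (errorConst T).coe_nonneg)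
  have hthreshold (s : ℝ) : (T + 3) * (C₂ A f (dynamicRange u)).toReal * √(Real.log n * x) * s =
      (C₄ A f (dynamicRange u)).toReal *
        (16 * (T + 3) * c * √(Real.log n / x) * (s * x / 16)) := by
    rw [sqrt_mul_eq_sqrt_div_mul _ (by linarith), hc]
    field_simp
  have hρ : 1 ≤ x / (192 * Real.log n) := by
    rw [one_le_div (by positivity)]
    exact hlog.trans (sqrt_le_self_of_one_le hnp.le)
  obtain ⟨hexists, hbound⟩ := existsUnique_isMLE_of_isExpander hlc hX hNT hu (by omega)
    (le_dynamicRange u) hc₄ (fun x hx => hlc.antitoneOn_score_add hx) (by linarith)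
    (by positivity) hρ (by omega) hK hexp (fun S hS => (hnoise S hS).trans_eq (hthreshold _))
    (by linarith)
  exact ⟨hexists, fun v hv => (hbound v hv).trans herror⟩

variable {u : Fin n → ℝ} {Ω : Type*} [MeasurableSpace Ω] {P : Measure Ω} [IsProbabilityMeasure P]
  {N : Pair n → Ω → ℕ} {X : Pair n → Fin T → Ω → ℝ}

lemma IsComparisonData.exists_measurableSet_good_sample
    (hdata : IsComparisonData A ν f T p u P N X) (hf : IsValid A ν f)
    (hlc : IsStrictlyLogConcave A f) (hT : 1 ≤ T) (hn : 2 ≤ n)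
    (hlog : 192 * Real.log n ≤ n * (p : ℝ)) (h₂ : C₂ A f (dynamicRange u) ≠ ⊤)
    (h₃ : C₃ A f (dynamicRange u) ≠ ⊤) :
    ∃ E, MeasurableSet E ∧ 1 - 9 / (n : ℝ) ^ 2 ≤ P.real E ∧ ∀ ω ∈ E,
      (∀ e, N e ω ≤ T) ∧ (∀ e t, X e t ω ∈ A) ∧
      IsExpander (fun e => (N e ω : ℝ)) (n * p) (n / (64 * T : ℕ)) (n * p / (192 * Real.log n)) ∧
      ∀ S : Finset (Fin n), S.Nonempty →
        |cutNoise f u (fun e => N e ω) (fun e t => X e t ω) S| ≤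
          (T + 3) * (C₂ A f (dynamicRange u)).toReal * √(Real.log n * (n * p)) * S.card := by
  refine exists_measurableSet_forall_mem ?_
  have hexp := measureReal_not_isExpander_le hdata.hasLaw_mult hdata.indep_mult hT hn hlog
  have hnoise := hdata.measureReal_exists_large_cutNoise_le hf hlc
    (ENNReal.toNNReal_pos (hf.C₂_ne_zero hlc (dynamicRange_nonneg u)) h₂)
    (fun x hx i j => abs_score_le_toReal_C₂ h₂ hx (abs_le.1 (le_dynamicRange u i j)))
    (fun x hx i j z hz => abs_scoreDeriv_le_toReal_C₃ h₃ hx (by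
      have hdist := abs_lt.1 (Real.dist_eq z _ ▸ Metric.mem_ball.1 hz)
      have hrange := abs_le.1 (le_dynamicRange u i j)
      constructor <;> linarith [hdist.1, hdist.2, hrange.1, hrange.2])) hn
    (by linarith [Real.log_natCast_nonneg n])
  refine (ENNReal.toReal_mono (measure_ne_top P _) (measure_mono_ae ?_)).trans
    ((measureReal_union_le _ _).trans ((add_le_add hexp hnoise).trans_eq (by ring)))
  filter_upwards [hdata.ae_mult_le, hdata.ae_outcome_mem hf] with ω hNT hX hbad
  by_contra hgood
  obtain ⟨hexp_good, hnoise_good⟩ := not_or.1 hgood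
  exact hbad ⟨hNT, hX, not_not.1 hexp_good, fun S hS => (not_le.1 fun hle =>
    hnoise_good ⟨S, hS, hle⟩).le⟩

theorem IsComparisonData.exists_measurableSet_existsUnique_isMLE
    (hdata : IsComparisonData A ν f T p u P N X) (hf : IsValid A ν f)
    (hlc : IsStrictlyLogConcave A f) (hT : 1 ≤ T) (hu : u ∈ normalized n)
    (hnp : 1 < n * (p : ℝ)) (hsmall : errorConst T * Delta A f (dynamicRange u) n p ≤ 2⁻¹) :
    ∃ E, MeasurableSet E ∧ 1 - 9 / (n : ℝ) ^ 2 ≤ P.real E ∧ ∀ ω ∈ E,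
      (∃! v, IsMLE f (fun e => N e ω) (fun e t => X e t ω) v) ∧
      ∀ v, IsMLE f (fun e => N e ω) (fun e t => X e t ω) v →
        ENNReal.ofReal ‖v - u‖ ≤ errorConst T * Delta A f (dynamicRange u) n p := by
  have hn := two_le_of_one_lt_mul hnp
  have hM := dynamicRange_nonneg u
  have herror : errorConst T * Delta A f (dynamicRange u) n p ≠ ⊤ :=
    ne_top_of_le_ne_top (by simp) hsmall
  have hΔ : Delta A f (dynamicRange u) n p ≠ ⊤ := fun htop => herror (by
    rw [htop, ENNReal.mul_top (by simp [errorConst])])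
  have hsmall' : errorConst T * (Delta A f (dynamicRange u) n p).toReal ≤ 1 / 2 := by
    simpa using ENNReal.toReal_mono (by simp) hsmall
  obtain ⟨h₂, h₃, -⟩ := hf.constants_of_Delta_ne_top hlc hM (rate_pos hn hnp) hΔ
  have hlog := (hf.mul_log_le_sqrt_of_Delta hlc hM hT hnp hΔ hsmall').trans
    (sqrt_le_self_of_one_le hnp.le)
  obtain ⟨E, hE, hPE, hgood⟩ := hdata.exists_measurableSet_good_sample hf hlc hT hn hlog h₂ h₃
  refine ⟨E, hE, hPE, fun ω hω => ?_⟩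
  obtain ⟨hNT, hX, hexp, hnoise⟩ := hgood ω hω
  refine (existsUnique_isMLE_of_good_sample hf hlc hT hu hnp hΔ hsmall' hNT hX hexp
    hnoise).imp_right fun hbound v hv => ?_
  rw [ENNReal.ofReal_le_iff_le_toReal herror, ENNReal.toReal_mul, ENNReal.coe_toReal]
  exact hbound v hv

lemma ae_eventually_mem_of_summable {E : ℕ → Set Ω} {ε : ℕ → ℝ} (hε : Summable ε)
    (hE : ∀ᶠ n in atTop, MeasurableSet (E n) ∧ 1 - ε n ≤ P.real (E n)) :
    ∀ᵐ ω ∂P, ∀ᶠ n in atTop, ω ∈ E n := by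
  obtain ⟨n₀, hn₀⟩ := eventually_atTop.1 hE
  have hle (n : ℕ) : P (E (n + n₀))ᶜ ≤ ENNReal.ofReal (ε (n + n₀)) := by
    obtain ⟨hmeas, hprob⟩ := hn₀ (n + n₀) (by omega)
    rw [← ofReal_measureReal, probReal_compl_eq_one_sub hmeas]
    exact ENNReal.ofReal_le_ofReal (by linarith)
  have hsum : ∑' n, P (E (n + n₀))ᶜ ≠ ⊤ := ne_top_of_le_ne_top
    ((summable_nat_add_iff n₀).2 hε).tsum_ofReal_ne_top (ENNReal.tsum_le_tsum hle)
  filter_upwards [ae_eventually_notMem hsum] with ω hω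
  rw [← map_add_atTop_eq_nat n₀]
  exact hω.mono fun n => not_not.1

lemma tendsto_zero_of_ofReal_le_mul {a : ℕ → ℝ} {D : ℕ → ℝ≥0∞} {C : ℝ≥0} (ha : ∀ n, 0 ≤ a n)
    (hD : Tendsto D atTop (𝓝 0)) (hle : ∀ᶠ n in atTop, ENNReal.ofReal (a n) ≤ C * D n) :
    Tendsto a atTop (𝓝 0) := by
  have hmul : Tendsto (fun n => C * D n) atTop (𝓝 0) := by
    simpa only [mul_zero] using ENNReal.Tendsto.const_mul hD (Or.inr ENNReal.coe_ne_top)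
  have hofReal := tendsto_of_tendsto_of_tendsto_of_le_of_le' tendsto_const_nhds hmul
    (Eventually.of_forall fun _ => zero_le) hle
  simpa only [Function.comp_def, ENNReal.toReal_ofReal (ha _), ENNReal.toReal_zero] using
    (ENNReal.tendsto_toReal ENNReal.zero_ne_top).comp hofReal

lemma IsValid.eventually_one_lt_of_tendsto [ν.IsNegInvariant] (hf : IsValid A ν f)
    (hlc : IsStrictlyLogConcave A f) {x M : ℕ → ℝ} (hx : ∀ᶠ n in atTop, 0 < x n)
    (hM : ∀ n, 0 ≤ M n)
    (hexist : Tendsto (fun n : ℕ => Real.log n / (x n * |Real.log (C₁ A ν f (M n))|))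
      atTop (𝓝 0)) : ∀ᶠ n in atTop, 1 < x n := by
  obtain ⟨B, hB, hC₁⟩ := hf.exists_abs_log_C₁_le hlc
  have hlog := Real.tendsto_log_atTop.comp tendsto_natCast_atTop_atTop
  filter_upwards [hx, hexist.eventually_lt_const (one_div_pos.2 hB), hlog.eventually_gt_atTop 1]
    with n hxn hlt hlogn
  obtain ⟨hpos, hle⟩ := hC₁ (M n) (hM n)
  rw [div_lt_div_iff₀ (by positivity) hB] at hlt
  have hlogx : Real.log n * B < x n * B :=
    hlt.trans_le (by rw [one_mul]; exact mul_le_mul_of_nonneg_left hle hxn.le)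
  exact hlogn.trans (lt_of_mul_lt_mul_right hlogx hB.le)

end Consistency

end PairwiseComparison

theorem mainTheorem1_general
    (A : Set ℝ) (ν : Measure ℝ) (f : ℝ → ℝ → ℝ)
    (hf : PairwiseComparison.IsValid A ν f)
    (hlc : PairwiseComparison.IsStrictlyLogConcave A f)
    (T : ℕ) (hT : 1 ≤ T)
    (p : ℕ → unitInterval)
    (u : (n : ℕ) → Fin n → ℝ) (hu : ∀ n, u n ∈ PairwiseComparison.normalized n)
    {Ω : Type*} [MeasurableSpace Ω] (P : Measure Ω) [IsProbabilityMeasure P]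
    (N : (n : ℕ) → PairwiseComparison.Pair n → Ω → ℕ)
    (X : (n : ℕ) → PairwiseComparison.Pair n → Fin T → Ω → ℝ)
    (hdata : ∀ n, PairwiseComparison.IsComparisonData A ν f T (p n) (u n) P (N n) (X n))
    (hnp : ∀ᶠ n : ℕ in atTop, 1 < (n : ℝ) * (p n : ℝ))
    (hDelta : Tendsto (fun n : ℕ =>
        PairwiseComparison.Delta A f (PairwiseComparison.dynamicRange (u n)) n (p n))
      atTop (𝓝 0)) :
    (∃ C : ℝ≥0, ∀ᶠ n : ℕ in atTop, ∃ E : Set Ω, MeasurableSet E ∧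
      1 - 14 / (n : ℝ) ^ 2 ≤ P.real E ∧
      ∀ ω ∈ E,
        (∃! v : Fin n → ℝ,
          PairwiseComparison.IsMLE f (fun e => N n e ω) (fun e t => X n e t ω) v) ∧
        ∀ v : Fin n → ℝ,
          PairwiseComparison.IsMLE f (fun e => N n e ω) (fun e t => X n e t ω) v →
          ENNReal.ofReal ‖v - u n‖ ≤
            C * PairwiseComparison.Delta A f (PairwiseComparison.dynamicRange (u n)) n (p n)) ∧
    (∀ᵐ ω ∂P,
      (∀ᶠ n : ℕ in atTop, ∃! v : Fin n → ℝ,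
        PairwiseComparison.IsMLE f (fun e => N n e ω) (fun e t => X n e t ω) v) ∧
      ∀ uhat : (n : ℕ) → Fin n → ℝ,
        (∀ᶠ n : ℕ in atTop,
          PairwiseComparison.IsMLE f (fun e => N n e ω) (fun e t => X n e t ω) (uhat n)) →
        Tendsto (fun n : ℕ => ‖uhat n - u n‖) atTop (𝓝 0)) := by
  open PairwiseComparison in
  have hsmall : ∀ᶠ n : ℕ in atTop,
      errorConst T * Delta A f (dynamicRange (u n)) n (p n) < 2⁻¹ :=
    (ENNReal.Tendsto.const_mul hDelta (Or.inr ENNReal.coe_ne_top)).eventually_lt_const (by simp)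
  have hevent := (hnp.and hsmall).mono fun n hn =>
    (hdata n).exists_measurableSet_existsUnique_isMLE hf hlc hT (hu n) hn.1 hn.2.le
  refine ⟨⟨errorConst T, hevent.mono fun n => ?_⟩, ?_⟩
  · rintro ⟨E, hE, hPE, hgood⟩
    exact ⟨E, hE, (sub_le_sub_left (by gcongr; norm_num) 1).trans hPE, hgood⟩
  obtain ⟨E, hE⟩ := hevent.choice
  have hsummable : Summable fun n : ℕ => 9 / (n : ℝ) ^ 2 := by
    simpa only [div_eq_mul_inv] using (Real.summable_nat_pow_inv.2 one_lt_two).mul_left 9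
  filter_upwards [ae_eventually_mem_of_summable hsummable
    (hE.mono fun n hn => ⟨hn.1, hn.2.1⟩)] with ω hω
  have hgood := (hE.and hω).mono fun n hn => hn.1.2.2 ω hn.2
  exact ⟨hgood.mono fun n hn => hn.1, fun uhat huhat =>
    tendsto_zero_of_ofReal_le_mul (fun n => norm_nonneg _) hDelta
      ((hgood.and huhat).mono fun n hn => hn.1.2 _ hn.2)⟩

theorem mainTheorem1
    (A : Set ℝ) (ν : Measure ℝ) [ν.IsNegInvariant] (f : ℝ → ℝ → ℝ)
    (hf : PairwiseComparison.IsValid A ν f)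
    (hlc : PairwiseComparison.IsStrictlyLogConcave A f)
    (T : ℕ) (hT : 1 ≤ T)
    (p : ℕ → unitInterval) (hp : ∀ n, 0 < (p n : ℝ))
    (u : (n : ℕ) → Fin n → ℝ) (hu : ∀ n, u n ∈ PairwiseComparison.normalized n)
    {Ω : Type*} [MeasurableSpace Ω] (P : Measure Ω) [IsProbabilityMeasure P]
    (N : (n : ℕ) → PairwiseComparison.Pair n → Ω → ℕ)
    (X : (n : ℕ) → PairwiseComparison.Pair n → Fin T → Ω → ℝ)
    (hdata : ∀ n, PairwiseComparison.IsComparisonData A ν f T (p n) (u n) P (N n) (X n))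
    (hexist : Tendsto (fun n : ℕ => Real.log n /
        (n * (p n : ℝ) *
          |Real.log (PairwiseComparison.C₁ A ν f (PairwiseComparison.dynamicRange (u n)))|))
      atTop (𝓝 0))
    (hDelta : Tendsto (fun n : ℕ =>
        PairwiseComparison.Delta A f (PairwiseComparison.dynamicRange (u n)) n (p n))
      atTop (𝓝 0)) :
    (∃ C : ℝ≥0, ∀ᶠ n : ℕ in atTop, ∃ E : Set Ω, MeasurableSet E ∧
      1 - 14 / (n : ℝ) ^ 2 ≤ P.real E ∧
      ∀ ω ∈ E,
        (∃! v : Fin n → ℝ,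
          PairwiseComparison.IsMLE f (fun e => N n e ω) (fun e t => X n e t ω) v) ∧
        ∀ v : Fin n → ℝ,
          PairwiseComparison.IsMLE f (fun e => N n e ω) (fun e t => X n e t ω) v →
          ENNReal.ofReal ‖v - u n‖ ≤
            C * PairwiseComparison.Delta A f (PairwiseComparison.dynamicRange (u n)) n (p n)) ∧
    (∀ᵐ ω ∂P,
      (∀ᶠ n : ℕ in atTop, ∃! v : Fin n → ℝ,
        PairwiseComparison.IsMLE f (fun e => N n e ω) (fun e t => X n e t ω) v) ∧
      ∀ uhat : (n : ℕ) → Fin n → ℝ,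
        (∀ᶠ n : ℕ in atTop,
          PairwiseComparison.IsMLE f (fun e => N n e ω) (fun e t => X n e t ω) (uhat n)) →
        Tendsto (fun n : ℕ => ‖uhat n - u n‖) atTop (𝓝 0)) :=
  mainTheorem1_general A ν f hf hlc T hT p u hu P N X hdata
    (hf.eventually_one_lt_of_tendsto hlc ((eventually_gt_atTop 0).mono fun n hn =>
      mul_pos (Nat.cast_pos.2 hn) (hp n)) (fun n => PairwiseComparison.dynamicRange_nonneg (u n))
      hexist) hDelta
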